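/- **Setting.** Let $M\ge 2$ and let $\mathcal N_i\subseteq\{1,\dots,M\}\setminus\{i\}$ be the set of neighbours of subsystem $i$. Subsystem $i$ has the dynamics $$x^i_{t+1}=A_{ii}x^i_t+B_{ii}u^i_t+\sum_{j\in\mathcal N_i}B_{ij}y^j_t,\qquad y^i_t=C_{ii}x^i_t+D_{ii}u^i_t,$$ with $x^i_t\in\mathbb R^n$, $u^i_t\in\mathbb R^m$, $y^i_t\in\mathbb R^p$. Put $y^{-i}=\mathrm{col}_{j\in\mathcal N_i}(y^j)$. The extended state is $\xi^i_t=(u^i_{[t-n,t-1]},y^{-i}_{[t-n,t-1]},y^i_{[t-n,t-1]})$ and $\xi_t=\mathrm{col}_i(\xi^i_t)$. Fix a horizon $L\ge 1$, compact sets $\mathcal U_i\subset\mathbb R^m$, weights $Q_i\succ0$, $R_i\succ0$, and recorded data $u^{i,\mathrm d}_{[0,N-1]},y^{-i,\mathrm d}_{[0,N-1]},y^{i,\mathrm d}_{[0,N-1]}$ that satisfy the dynamics of subsystem $i$. $H_T(\cdot)$ denotes the Hankel matrix with $T$ block rows; a sequence of $N$ vectors of dimension $d$ is persistently exciting of order $T$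 if its $H_T$ has rank $dT$. Write $\|x\|_P^2=x^\top Px$. For every $i$ fix a matrix $\tilde C_{ii}$ such that $y^i_t=\tilde C_{ii}\xi^i_t+D_{ii}u^i_t$ along all trajectories of subsystem $i$. **Assumption 1.** $(A_{ii},[B_{ii}\ B_{ij},\,j\in\mathcal N_i])$ is controllable and $(u^{i,\mathrm d},y^{-i,\mathrm d})$ is persistently exciting of order $L+2n$, for all $i$; the pair $(A,C)$ is observable, where $C=\mathrm{diag}_i(C_{ii})$ and $A$ has diagonal blocks $A_{ii}$ and off-diagonal blocks $A_{ij}=B_{ij}C_{jj}$ if $j\in\mathcal N_i$, $A_{ij}=0$ otherwise. **Assumption 2.** There are $P_i\succ0$, $\eta_i,\epsilon_i>0$ and $\kappa_i:\mathcal X_i^{\mathrm f}(\epsilon_i)\to\mathcal U_i$, where $\mathcal X_i^{\mathrm f}(e)=\{\xi^i:\|\xi^i\|_{P_i}^2\le e\}$, such that for all vectors $\xi^1,\dots,\xi^M$ with $\xi^i\in\mathcal X^{\mathrm f}_i(\epsilon_i)$ for all $i$, with $y^i=\tilde C_{ii}\xi^i+D_{ii}\kappa_i(\xi^i)$, and with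 $\xi^{i,+}$ obtained from $\xi^i$ by deleting the oldest entries of its three blocks and appending $\kappa_i(\xi^i)$, $y^{-i}$, $y^i$ respectively, one has for all $i$ $$\|\xi^{i,+}\|_{P_i}^2-\|\xi^i\|_{P_i}^2\le-\eta_i\|\xi^i\|^2-\|y^i\|_{Q_i}^2-\|\kappa_i(\xi^i)\|_{R_i}^2 .$$ The tightening factors $\theta_i\in(0,1)$ satisfy $\theta_i\ge1-\eta_i\lambda_{\max}(P_i)^{-1}$. **Scheme.** Let $\Omega_i\ge0$ and $\Omega=\max_i\Omega_i$. The local problem of subsystem $i$ at time $t$ is to minimise, over $\alpha$, $\sum_{k=0}^{L-1}(\|y_k\|_{Q_i}^2+\|u_k\|_{R_i}^2)+\|\xi_L\|_{P_i}^2$ subject to $$H_{L+n}(u^{i,\mathrm d}_{[0,N-1]})\alpha=u_{[-n,L-1]},\quad H_{L+n-1}(y^{-i,\mathrm d}_{[0,N-2]})\alpha=y^{-i,*}_{[-n+1,L-1]}(t-1),\quad H_{L+n}(y^{i,\mathrm d}_{[0,N-1]})\alpha=y_{[-n,L-1]},$$ $u_{[-n,-1]}=u^i_{[t-n,t-1]}$,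 $y_{[-n,-1]}=y^i_{[t-n,t-1]}$, $\xi_L=(u_{[L-n,L-1]},y^{-i,*}_{[L-n+1,L]}(t-1),y_{[L-n,L-1]})\in\mathcal X^{\mathrm f}_i(\theta_i\epsilon_i)$ and, for $0\le k\le L-1$, $u_k\in\mathcal U_i$, $\|u_k-u^{i,*}_{k+1}(t-1)\|^2\le\|\hat u^i_k(t)-u^{i,*}_{k+1}(t-1)\|^2+\Omega_i$ and $\|y_k-y^{i,*}_{k+1}(t-1)\|^2\le\|\hat y^i_k(t)-y^{i,*}_{k+1}(t-1)\|^2+\Omega_i$. At each time $t=0,1,\dots$ every subsystem computes an optimal solution $u^{i,*}_{[-n,L-1]}(t),y^{i,*}_{[-n,L-1]}(t)$, with terminal vector $\xi^{i,*}_L(t)$; applies $u^i_t=u^{i,*}_0(t)$ and measures $y^i_t$; extends the solution by $u^{i,*}_L(t)=\kappa_i(\xi^{i,*}_L(t))$ and by the output $y^{i,*}_L(t)$ obtained by data-driven simulation (below) over $L+1$ steps with the input $u^{i,*}_{[-n,L]}(t)$, the neighbours' outputs $y^{-i,*}_{[-n+1,L]}(t-1)$ and the past outputs $y^{i,*}_{[-n,-1]}(t)$;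 communicates $y^{i,*}_{[-n+1,L]}(t)$; and forms the candidate $\hat u^i_{[-n,L-2]}(t+1)=u^{i,*}_{[-n+1,L-1]}(t)$, $\hat u^i_{L-1}(t+1)=\kappa_i(\hat\xi^i_{L-1}(t+1))$, where $\hat\xi^i_{L-1}(t+1)=(\hat u^i_{[L-n-1,L-2]}(t+1),y^{-i,*}_{[L-n,L-1]}(t),\hat y^i_{[L-n-1,L-2]}(t+1))$, $\hat y^i_{[-n,-1]}(t+1)=y^i_{[t+1-n,t]}$ is measured, and $\hat y^i_{[0,L-1]}(t+1)$ is simulated over $L$ steps with the input $\hat u^i_{[-n,L-1]}(t+1)$ and the neighbours' outputs $y^{-i,*}_{[-n+1,L-1]}(t)$. Data-driven simulation over $\ell$ steps with input $u_{[-n,\ell-1]}$, neighbours' outputs $v_{[-n,\ell-2]}$ and past outputs $y_{[-n,-1]}$ solves $$H_{\ell+n}(u^{i,\mathrm d}_{[0,N-1]})\alpha=u_{[-n,\ell-1]},\quad H_{\ell+n-1}(y^{-i,\mathrm d}_{[0,N-2]})\alpha=v_{[-n,\ell-2]},\quad H_n(y^{i,\mathrm d}_{[0,N-\ell-1]})\alpha=y_{[-n,-1]}$$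 for $\alpha$ and returns $y_{[0,\ell-1]}=H_\ell(y^{i,\mathrm d}_{[n,N-1]})\alpha$. **Assumption 3.** At time $0$ there are candidates $\hat u^i_{[-n,L-1]}(0),\hat y^i_{[-n,L-1]}(0)$ that are feasible in the local problems with $u^{i,*}_{[-n+1,L]}(-1)=\hat u^i_{[-n,L-1]}(0)$ and $y^{i,*}_{[-n+1,L]}(-1)=\hat y^i_{[-n,L-1]}(0)$. **Assumption 4.** For given $\tilde\sigma_i,\sigma_i'\in\mathcal K$: $\|\hat\xi^i_{L-1}(t+1)-\xi^{i,*}_L(t)\|_{P_i}\le\tilde\sigma_i(\Omega_i)$ and $\|\hat y^i_k(t+1)-y^{i,*}_{k+1}(t)\|_{Q_i}\le\sigma'_i(\Omega_i)$ for all $i$, $t\ge0$ and $0\le k\le L-2$. **Assumption 5.** For a given $c_{\mathrm{ub}}>0$, the sum $V_t^*$ over $i$ of the optimal costs satisfies $V^*_t\le c_{\mathrm{ub}}\|\xi_t\|^2$ for all $t\ge0$. **Theorem.** Let Assumptions 1 and 2 hold, and let $\tilde\sigma_i,\sigma_i'\in\mathcal K$ and $c_{\mathrm{ub}}>0$ be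 given. There exist $\beta\in\mathcal{KL}$, $\delta\in\mathcal K$ and $\Omega_{\max}>0$ such that for all $\Omega_1,\dots,\Omega_M\ge0$ with $\Omega=\max_i\Omega_i\le\Omega_{\max}$ and every execution of the scheme in closed loop with the network for which Assumptions 3, 4 and 5 hold (with these $\tilde\sigma_i,\sigma_i',c_{\mathrm{ub}}$), $$\|\xi_t\|\le\beta(\|\xi_0\|,t)+\delta(\Omega)\qquad\text{for all }t,$$ that is, the origin of the closed loop is input-to-state stable with respect to $\Omega$. The execution is not assumed to be infinite: if it has been carried out up to a time $T$ and Assumptions 4 and 5 hold up to $T$, then the bound holds for $t\le T$, and all local problems are feasible at time $T+1$. -/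

import Mathlib

open Matrix Set Filter Topology

noncomputable section

/-! ### Comparison functions and norms -/

/-- Class `K` (only the values on `[0, ∞)` matter): continuous, strictly increasing, zero at zero. -/
def IsClassK (σ : ℝ → ℝ) : Prop :=
  ContinuousOn σ (Ici 0) ∧ StrictMonoOn σ (Ici 0) ∧ σ 0 = 0

/-- Class `KL`: class `K` in the first argument; for every positive first argument continuous,
strictly decreasing and tending to zero in the second argument. -/
def IsClassKL (β : ℝ → ℝ → ℝ) : Prop :=
  (∀ t, 0 ≤ t → IsClassK (fun r => β r t)) ∧
  ∀ r, 0 < r → ContinuousOn (β r) (Ici 0) ∧ StrictAntiOn (β r) (Ici 0) ∧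
    Tendsto (β r) atTop (𝓝 0)

/-- The Euclidean norm of a finite real vector. -/
def euclNorm {ι : Type*} [Fintype ι] (x : ι → ℝ) : ℝ :=
  ‖(WithLp.toLp 2 x : EuclideanSpace ℝ ι)‖

/-- The weighted square `‖x‖_P ^ 2 = xᵀ P x`. -/
def wsq {ι : Type*} [Fintype ι] (P : Matrix ι ι ℝ) (x : ι → ℝ) : ℝ := x ⬝ᵥ (P *ᵥ x)

/-- The weighted norm `‖x‖_P`. -/
def wnorm {ι : Type*} [Fintype ι] (P : Matrix ι ι ℝ) (x : ι → ℝ) : ℝ := √(wsq P x)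

/-- The largest eigenvalue of a symmetric matrix. -/
def lambdaMax {ι : Type*} [Fintype ι] [DecidableEq ι] (P : Matrix ι ι ℝ) : ℝ :=
  sSup (spectrum ℝ P)

/-! ### Signals, Hankel matrices, controllability and observability

Signals are indexed by `ℤ`; only the values on the relevant finite ranges matter. -/

/-- The stacked vector `w_[a, a+T-1]`. -/
def window {κ : Type*} (w : ℤ → κ → ℝ) (a : ℤ) (T : ℕ) : Fin T × κ → ℝ :=
  fun q => w (a + (q.1 : ℕ)) q.2

/-- Hankel matrix with `T` block rows and `K` columns of the data `d_a, d_{a+1}, …`; with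
`K = N + 1 - T` and `a = 0` it is `H_T(d_[0, N-1])`. -/
def hankel {κ : Type*} (d : ℤ → κ → ℝ) (a : ℤ) (T K : ℕ) : Matrix (Fin T × κ) (Fin K) ℝ :=
  Matrix.of fun q s => d (a + (q.1 : ℕ) + (s : ℕ)) q.2

/-- `d_[0, N-1]` is persistently exciting of order `T`. -/
def PersistentlyExciting {κ : Type*} [Fintype κ] (d : ℤ → κ → ℝ) (N T : ℕ) : Prop :=
  (hankel d 0 T (N + 1 - T)).rank = Fintype.card κ * T

/-- Kalman's rank condition for controllability of `(A, B)`. -/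
def IsControllable {ι κ : Type*} [Fintype ι] [DecidableEq ι] [Fintype κ]
    (A : Matrix ι ι ℝ) (B : Matrix ι κ ℝ) : Prop :=
  (Matrix.of fun (r : ι) (q : Fin (Fintype.card ι) × κ) =>
    (A ^ (q.1 : ℕ) * B) r q.2).rank = Fintype.card ι

/-- Kalman's rank condition for observability of `(A, C)`. -/
def IsObservable {ι κ : Type*} [Fintype ι] [DecidableEq ι] [Fintype κ]
    (A : Matrix ι ι ℝ) (C : Matrix κ ι ℝ) : Prop :=
  (Matrix.of fun (q : Fin (Fintype.card ι) × κ) (s : ι) =>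
    (C * A ^ (q.1 : ℕ)) q.2 s).rank = Fintype.card ι

/-- Shift register: drop the oldest of `n` stacked blocks and append `z`. -/
def shiftIn {κ : Type*} {n : ℕ} (w : Fin n × κ → ℝ) (z : κ → ℝ) : Fin n × κ → ℝ :=
  fun q => if h : (q.1 : ℕ) + 1 < n then w (⟨(q.1 : ℕ) + 1, h⟩, q.2) else z q.2

/-! ### The network of coupled subsystems -/

/-- `M` coupled subsystems
`x⁺ = A i x + B i u + ∑ j ∈ nbr i, E i j y^j`, `y = C i x + D i u`. -/
structure Network (M n m p : ℕ) where
  nbr : Fin M → Finset (Fin M)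
  self_notMem : ∀ i, i ∉ nbr i
  A : Fin M → Matrix (Fin n) (Fin n) ℝ
  B : Fin M → Matrix (Fin n) (Fin m) ℝ
  E : Fin M → Fin M → Matrix (Fin n) (Fin p) ℝ
  C : Fin M → Matrix (Fin p) (Fin n) ℝ
  D : Fin M → Matrix (Fin p) (Fin m) ℝ

namespace Network

variable {M n m p : ℕ} (S : Network M n m p)

/-- Index type of the stacked output `y^{-i}` of the neighbours of `i`. -/
abbrev NIdx (i : Fin M) : Type := {j // j ∈ S.nbr i} × Fin p

/-- Index type of the extended state `ξ^i = (u^i_[t-n,t-1], y^{-i}_[t-n,t-1], y^i_[t-n,t-1])`. -/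
abbrev Ext (i : Fin M) : Type := (Fin n × Fin m) ⊕ ((Fin n × S.NIdx i) ⊕ (Fin n × Fin p))

/-- `y^{-i} = col_{j ∈ nbr i} y^j`. -/
def nbrVec (i : Fin M) (y : Fin M → Fin p → ℝ) : S.NIdx i → ℝ := fun q => y q.1 q.2

/-- `[E i j]_{j ∈ nbr i}`. -/
def Bnbr (i : Fin M) : Matrix (Fin n) (S.NIdx i) ℝ := Matrix.of fun r q => S.E i q.1 r q.2

/-- `[B i, [E i j]_{j ∈ nbr i}]`. -/
def inputMat (i : Fin M) : Matrix (Fin n) (Fin m ⊕ S.NIdx i) ℝ :=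
  Matrix.fromCols (S.B i) (S.Bnbr i)

/-- Global state matrix with blocks `A_ii`, and `E i j * C j` for `j ∈ nbr i`, zero otherwise. -/
def globalA : Matrix (Fin M × Fin n) (Fin M × Fin n) ℝ :=
  Matrix.of fun a b =>
    if a.1 = b.1 then S.A a.1 a.2 b.2
    else if b.1 ∈ S.nbr a.1 then (S.E a.1 b.1 * S.C b.1) a.2 b.2 else 0

/-- `diag_i (C i)`. -/
def globalC : Matrix (Fin M × Fin p) (Fin M × Fin n) ℝ :=
  Matrix.of fun a b => if a.1 = b.1 then S.C a.1 a.2 b.2 else 0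

/-- `(u, v, y)` restricted to the times `a, …, b` is a trajectory of subsystem `i` with input `u`,
neighbours' output `v` and output `y`. -/
def IsLocalTraj (i : Fin M) (a b : ℤ) (u : ℤ → Fin m → ℝ) (v : ℤ → S.NIdx i → ℝ)
    (y : ℤ → Fin p → ℝ) : Prop :=
  ∃ x : ℤ → Fin n → ℝ, ∀ k, a ≤ k → k ≤ b →
    x (k + 1) = S.A i *ᵥ x k + S.B i *ᵥ u k + S.Bnbr i *ᵥ v k ∧
    y k = S.C i *ᵥ x k + S.D i *ᵥ u k

/-- The extended-state vector `(u_[a,a+n-1], v_[b,b+n-1], y_[a,a+n-1])`. -/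
def ext (i : Fin M) (u : ℤ → Fin m → ℝ) (v : ℤ → S.NIdx i → ℝ) (y : ℤ → Fin p → ℝ)
    (a b : ℤ) : S.Ext i → ℝ :=
  Sum.elim (window u a n) (Sum.elim (window v b n) (window y a n))

/-- `Ct = [G_n … G_1 | S_n … S_1 | F_n … F_1]` is an output matrix of the extended-state system of
subsystem `i`: along every trajectory of the subsystem, `y_t = Ct ξ_t + D_ii u_t`. -/
def IsExtOutputMat (i : Fin M) (Ct : Matrix (Fin p) (S.Ext i) ℝ) : Prop :=
  ∀ (u : ℤ → Fin m → ℝ) (v : ℤ → S.NIdx i → ℝ) (y : ℤ → Fin p → ℝ) (t : ℤ),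
    S.IsLocalTraj i (t - n) t u v y →
      y t = Ct *ᵥ S.ext i u v y (t - n) (t - n) + S.D i *ᵥ u t

/-- Output of the extended-state system of subsystem `i`. -/
def extOut (i : Fin M) (Ct : Matrix (Fin p) (S.Ext i) ℝ) (ξ : S.Ext i → ℝ) (u : Fin m → ℝ) :
    Fin p → ℝ :=
  Ct *ᵥ ξ + S.D i *ᵥ u

/-- Successor state of the extended-state system of subsystem `i` under the input `u` and the
neighbours' output `v`: the three registers are shifted, and `u`, `v` and the current output are
appended. -/
def extNext (i : Fin M) (Ct : Matrix (Fin p) (S.Ext i) ℝ) (ξ : S.Ext i → ℝ) (u : Fin m → ℝ)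
    (v : S.NIdx i → ℝ) : S.Ext i → ℝ :=
  Sum.elim (shiftIn (fun q => ξ (Sum.inl q)) u)
    (Sum.elim (shiftIn (fun q => ξ (Sum.inr (Sum.inl q))) v)
      (shiftIn (fun q => ξ (Sum.inr (Sum.inr q))) (S.extOut i Ct ξ u)))

end Network

/-! ### The distributed MPC scheme -/

/-- Data and design parameters of the scheme: data length `N`, horizon `L`, the recorded data
`(ud i, vd i, yd i)` of each subsystem (input, neighbours' outputs, output at times
`0, …, N-1`), input constraint sets `U i`, weights `Q i`, `R i`, terminal weights `P i`, terminal
levels `ε i`, tightening factors `θ i` and terminal control laws `κ i` (the values of `κ i` outside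
the terminal region are irrelevant). -/
structure Scheme {M n m p : ℕ} (S : Network M n m p) where
  N : ℕ
  L : ℕ
  ud : Fin M → ℤ → Fin m → ℝ
  vd : (i : Fin M) → ℤ → S.NIdx i → ℝ
  yd : Fin M → ℤ → Fin p → ℝ
  U : Fin M → Set (Fin m → ℝ)
  Q : Fin M → Matrix (Fin p) (Fin p) ℝ
  R : Fin M → Matrix (Fin m) (Fin m) ℝ
  P : (i : Fin M) → Matrix (S.Ext i) (S.Ext i) ℝ
  ε : Fin M → ℝ
  θ : Fin M → ℝ
  κ : (i : Fin M) → (S.Ext i → ℝ) → Fin m → ℝ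

/-- The signals occurring in an execution of the scheme: closed-loop inputs and outputs
`u i t`, `y i t`; optimal predictions `us t i k = u^{i,*}_k(t)`, `ys t i k = y^{i,*}_k(t)`
(`t = -1` is the initially communicated trajectory); candidates `uh t i k = û^i_k(t)`,
`yh t i k = ŷ^i_k(t)`. -/
structure Execution (M m p : ℕ) where
  u : Fin M → ℤ → Fin m → ℝ
  y : Fin M → ℤ → Fin p → ℝ
  us : ℤ → Fin M → ℤ → Fin m → ℝ
  ys : ℤ → Fin M → ℤ → Fin p → ℝ
  uh : ℤ → Fin M → ℤ → Fin m → ℝ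
  yh : ℤ → Fin M → ℤ → Fin p → ℝ

namespace Scheme

variable {M n m p : ℕ} {S : Network M n m p} (Z : Scheme S)

/-- The standing data assumption: the data are trajectories of the subsystems, `(A_ii, B_i)` is
controllable, the data are persistently exciting of order `L + 2 n`, and the global pair `(A, C)` is
observable. -/
structure DataAssumption : Prop where
  traj : ∀ i, S.IsLocalTraj i 0 ((Z.N : ℤ) - 1) (Z.ud i) (Z.vd i) (Z.yd i)
  controllable : ∀ i, IsControllable (S.A i) (S.inputMat i)
  exciting : ∀ i, PersistentlyExciting (fun k => Sum.elim (Z.ud i k) (Z.vd i k)) Z.N (Z.L + 2 * n)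
  observable : IsObservable S.globalA S.globalC

/-- The terminal region `X_i^f(e) = {ξ | ‖ξ‖_{P_i}^2 ≤ e}`. -/
def terminalSet (i : Fin M) (e : ℝ) : Set (S.Ext i → ℝ) := {ξ | wsq (Z.P i) ξ ≤ e}

/-- Terminal ingredients with decrease rates `η i`, for the extended-state output matrices `Ct`. -/
structure TerminalAssumption (Ct : (i : Fin M) → Matrix (Fin p) (S.Ext i) ℝ) (η : Fin M → ℝ) :
    Prop where
  posDef : ∀ i, (Z.P i).PosDef
  η_pos : ∀ i, 0 < η i
  ε_pos : ∀ i, 0 < Z.ε i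
  mem : ∀ i, ∀ ξ ∈ Z.terminalSet i (Z.ε i), Z.κ i ξ ∈ Z.U i
  decrease : ∀ ξ : (i : Fin M) → S.Ext i → ℝ, (∀ i, ξ i ∈ Z.terminalSet i (Z.ε i)) →
    ∀ i, wsq (Z.P i) (S.extNext i (Ct i) (ξ i) (Z.κ i (ξ i))
          (S.nbrVec i fun j => S.extOut j (Ct j) (ξ j) (Z.κ j (ξ j))))
        - wsq (Z.P i) (ξ i)
      ≤ - η i * euclNorm (ξ i) ^ 2 - wsq (Z.Q i) (S.extOut i (Ct i) (ξ i) (Z.κ i (ξ i)))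
        - wsq (Z.R i) (Z.κ i (ξ i))

/-- Data-driven simulation over `ℓ` steps: `y_[0,ℓ-1]` is the simulated output of subsystem `i` for
the past `u_[-n,-1]`, `v_[-n,-1]`, `y_[-n,-1]` and the new `u_[0,ℓ-1]`, `v_[0,ℓ-2]`. -/
def IsSim (i : Fin M) (ℓ : ℕ) (u : ℤ → Fin m → ℝ) (v : ℤ → S.NIdx i → ℝ) (y : ℤ → Fin p → ℝ) :
    Prop :=
  ∃ α : Fin (Z.N + 1 - (ℓ + n)) → ℝ,
    hankel (Z.ud i) 0 (ℓ + n) _ *ᵥ α = window u (-n) (ℓ + n) ∧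
    hankel (Z.vd i) 0 (ℓ + n - 1) _ *ᵥ α = window v (-n) (ℓ + n - 1) ∧
    hankel (Z.yd i) 0 n _ *ᵥ α = window y (-n) n ∧
    hankel (Z.yd i) n ℓ _ *ᵥ α = window y 0 ℓ

/-- `k ↦ y^{-i,*}_k(t)`. -/
def comm (S : Network M n m p) (e : Execution M m p) (t : ℤ) (i : Fin M) : ℤ → S.NIdx i → ℝ :=
  fun k => S.nbrVec i fun j => e.ys t j k

/-- Predicted terminal extended state `ξ_L^i(t)` for predicted `u`, `y`. -/
def predTerminal (e : Execution M m p) (t : ℤ) (i : Fin M) (u : ℤ → Fin m → ℝ)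
    (y : ℤ → Fin p → ℝ) : S.Ext i → ℝ :=
  S.ext i u (comm S e (t - 1) i) y (Z.L - n) (Z.L - n + 1)

/-- Cost of the local MPC problem of subsystem `i` at time `t`. -/
def cost (e : Execution M m p) (t : ℤ) (i : Fin M) (u : ℤ → Fin m → ℝ) (y : ℤ → Fin p → ℝ) : ℝ :=
  ∑ k ∈ Finset.range Z.L, (wsq (Z.Q i) (y k) + wsq (Z.R i) (u k))
    + wsq (Z.P i) (Z.predTerminal e t i u y)

/-- `(α, u, y)` satisfies the constraints of the local MPC problem of subsystem `i` at time `t`,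
with consistency margin `Ωi`. -/
structure Feasible (Ωi : ℝ) (e : Execution M m p) (t : ℤ) (i : Fin M)
    (α : Fin (Z.N + 1 - (Z.L + n)) → ℝ) (u : ℤ → Fin m → ℝ) (y : ℤ → Fin p → ℝ) : Prop where
  hankel_u : hankel (Z.ud i) 0 (Z.L + n) _ *ᵥ α = window u (-n) (Z.L + n)
  hankel_v : hankel (Z.vd i) 0 (Z.L + n - 1) _ *ᵥ α
    = window (comm S e (t - 1) i) (-n + 1) (Z.L + n - 1)
  hankel_y : hankel (Z.yd i) 0 (Z.L + n) _ *ᵥ α = window y (-n) (Z.L + n)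
  init_u : window u (-n) n = window (e.u i) (t - n) n
  init_y : window y (-n) n = window (e.y i) (t - n) n
  input : ∀ k : ℤ, 0 ≤ k → k ≤ Z.L - 1 → u k ∈ Z.U i
  terminal : Z.predTerminal e t i u y ∈ Z.terminalSet i (Z.θ i * Z.ε i)
  consistency_u : ∀ k : ℤ, 0 ≤ k → k ≤ Z.L - 1 →
    euclNorm (u k - e.us (t - 1) i (k + 1)) ^ 2
      ≤ euclNorm (e.uh t i k - e.us (t - 1) i (k + 1)) ^ 2 + Ωi
  consistency_y : ∀ k : ℤ, 0 ≤ k → k ≤ Z.L - 1 →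
    euclNorm (y k - e.ys (t - 1) i (k + 1)) ^ 2
      ≤ euclNorm (e.yh t i k - e.ys (t - 1) i (k + 1)) ^ 2 + Ωi

/-- `(u, y)` are the input and output sequences of an optimal solution of the local MPC problem. -/
def IsOptimal (Ωi : ℝ) (e : Execution M m p) (t : ℤ) (i : Fin M) (u : ℤ → Fin m → ℝ)
    (y : ℤ → Fin p → ℝ) : Prop :=
  (∃ α, Z.Feasible Ωi e t i α u y) ∧
  ∀ α' u' y', Z.Feasible Ωi e t i α' u' y' → Z.cost e t i u y ≤ Z.cost e t i u' y'

/-- Candidate extended state `ξ̂_{L-1}^i(t)`. -/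
def candState (e : Execution M m p) (t : ℤ) (i : Fin M) : S.Ext i → ℝ :=
  S.ext i (e.uh t i) (comm S e (t - 1) i) (e.yh t i) (Z.L - n - 1) (Z.L - n)

/-- Initially feasible candidate at time `0`, which is also the initially communicated
trajectory. -/
structure InitialAssumption (Ω : Fin M → ℝ) (e : Execution M m p) : Prop where
  comm_u : ∀ i, ∀ k : ℤ, -n ≤ k → k ≤ Z.L - 1 → e.us (-1) i (k + 1) = e.uh 0 i k
  comm_y : ∀ i, ∀ k : ℤ, -n ≤ k → k ≤ Z.L - 1 → e.ys (-1) i (k + 1) = e.yh 0 i k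
  feasible : ∀ i, ∃ α, Z.Feasible (Ω i) e 0 i α (e.uh 0 i) (e.yh 0 i)

/-- One pass of the loop of the scheme at time `t`. -/
structure Step (Ω : Fin M → ℝ) (e : Execution M m p) (t : ℤ) : Prop where
  /-- solve the local MPC problems -/
  optimal : ∀ i, Z.IsOptimal (Ω i) e t i (e.us t i) (e.ys t i)
  /-- apply the first input -/
  apply : ∀ i, e.u i t = e.us t i 0
  /-- extend the optimal input by one step -/
  extend_u : ∀ i, e.us t i Z.L = Z.κ i (Z.predTerminal e t i (e.us t i) (e.ys t i))
  /-- extend the optimal output by one step, by data-driven simulation -/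
  extend_y : ∀ i, ∃ y : ℤ → Fin p → ℝ,
    Z.IsSim i (Z.L + 1) (e.us t i) (fun k => comm S e (t - 1) i (k + 1)) y ∧
    (∀ k : ℤ, -n ≤ k → k ≤ -1 → y k = e.ys t i k) ∧
    e.ys t i Z.L = y Z.L
  /-- candidate input for the next time -/
  cand_u : ∀ i, ∀ k : ℤ, -n ≤ k → k ≤ Z.L - 2 → e.uh (t + 1) i k = e.us t i (k + 1)
  cand_u_last : ∀ i, e.uh (t + 1) i (Z.L - 1) = Z.κ i (Z.candState e (t + 1) i)
  /-- candidate output for the next time: measured past, then data-driven simulation -/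
  cand_y_past : ∀ i, ∀ k : ℤ, -n ≤ k → k ≤ -1 → e.yh (t + 1) i k = e.y i (t + 1 + k)
  cand_y : ∀ i, Z.IsSim i Z.L (e.uh (t + 1) i) (fun k => comm S e t i (k + 1)) (e.yh (t + 1) i)

/-- `e` is an execution of the scheme at the times `0, …, T` in closed loop with the network,
with an initially feasible candidate. -/
structure IsExecution (Ω : Fin M → ℝ) (e : Execution M m p) (T : ℕ) : Prop where
  plant : ∀ i, S.IsLocalTraj i (-n) T (e.u i) (fun k => S.nbrVec i fun j => e.y j k) (e.y i)
  initial : Z.InitialAssumption Ω e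
  step : ∀ t : ℤ, 0 ≤ t → t ≤ T → Z.Step Ω e t

/-- The predictions change only little from one time to the next, up to time `T`. -/
structure DeviationBound (σt σp : Fin M → ℝ → ℝ) (Ω : Fin M → ℝ) (e : Execution M m p) (T : ℕ) :
    Prop where
  state : ∀ i, ∀ t : ℤ, 0 ≤ t → t ≤ T →
    wnorm (Z.P i) (Z.candState e (t + 1) i - Z.predTerminal e t i (e.us t i) (e.ys t i))
      ≤ σt i (Ω i)
  output : ∀ i, ∀ t k : ℤ, 0 ≤ t → t ≤ T → 0 ≤ k → k ≤ Z.L - 2 →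
    wnorm (Z.Q i) (e.yh (t + 1) i k - e.ys t i (k + 1)) ≤ σp i (Ω i)

/-- Sum of the optimal costs `V_t^*`. -/
def optCost (e : Execution M m p) (t : ℤ) : ℝ :=
  ∑ i, Z.cost e t i (e.us t i) (e.ys t i)

end Scheme

/-- The global extended state `ξ_t = col_i ξ_t^i` of the closed loop. -/
def globalExt {M n m p : ℕ} (S : Network M n m p) (e : Execution M m p) (t : ℤ) :
    (Σ i, S.Ext i) → ℝ :=
  fun q => S.ext q.1 (e.u q.1) (fun k => S.nbrVec q.1 fun j => e.y j k) (e.y q.1)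
    (t - n) (t - n) q.2

end

/-! The previous optimal solution, shifted by one step and completed by the terminal controller,
stays feasible, and the summed optimal cost V is almost a Lyapunov function.

Feasibility: combinations of data windows are trajectories (`Network.IsLocalTraj.of_hankel`), and
inputs and past outputs determine the outputs, so simulated, predicted and measured signals can be
compared. For small Ω the deviation bound puts the candidate state into the untightened terminal
region (`Scheme.Step.candState_mem`). The terminal decrease is then applied to a mixed vector: the
candidate state in component i, the old terminal predictions elsewhere. Since i is not its own
neighbour, the neighbours' outputs are exactly the communicated ones (`Scheme.Step.cand_decrease`),
and the decrease leads back into the tightened region.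

Cost: Young's inequality, with a small μ that does not depend on Ω, gives V(t+1) ≤ (1+μ)V(t) - c
f(t) + d, where f(t) sums the squared norms of all inputs and outputs at time t and d is quadratic
in the deviation bounds (`Scheme.Step.cand_cost_le`, `Scheme.IsExecution.first_output`).

Stability: f sees only the present, whereas ‖ξ_t‖² is equivalent to the sum of f over the last n
instants. Adding to V a multiple of `weightedPast`, whose increment is n f(t) minus that sum, gives
a decrease in ‖ξ_t‖². Half of it absorbs μV ≤ μ cub ‖ξ_t‖²; the other half yields an exponential
contraction up to d (`sq_le_of_cost_decrease`). -/

section MatrixOrder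

/-! ### Weighted norms and Young's inequality -/

open scoped MatrixOrder

theorem wsq_one {ι : Type*} [Fintype ι] [DecidableEq ι] (x : ι → ℝ) :
    wsq 1 x = euclNorm x ^ 2 := by
  rw [euclNorm, EuclideanSpace.norm_sq_eq]
  simp [wsq, dotProduct, pow_two]

theorem wsq_algebraMap {ι : Type*} [Fintype ι] [DecidableEq ι] (c : ℝ) (x : ι → ℝ) :
    wsq (algebraMap ℝ (Matrix ι ι ℝ) c) x = c * euclNorm x ^ 2 := by
  rw [← wsq_one, wsq, wsq, Algebra.algebraMap_eq_smul_one, Matrix.smul_mulVec, dotProduct_smul,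
    smul_eq_mul]

theorem wsq_mono {ι : Type*} [Fintype ι] {P P' : Matrix ι ι ℝ} (h : P ≤ P') (x : ι → ℝ) :
    wsq P x ≤ wsq P' x := by
  have h2 := (Matrix.le_iff.1 h).dotProduct_mulVec_nonneg x
  rw [Matrix.sub_mulVec, dotProduct_sub, star_trivial] at h2
  exact sub_nonneg.1 h2

theorem wsq_nonneg {ι : Type*} [Fintype ι] {P : Matrix ι ι ℝ} (hP : P.PosDef) (x : ι → ℝ) :
    0 ≤ wsq P x := by
  simpa [wsq] using hP.posSemidef.dotProduct_mulVec_nonneg x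

theorem wsq_le_lambdaMax {ι : Type*} [Fintype ι] [DecidableEq ι] {P : Matrix ι ι ℝ}
    (hP : P.PosDef) (x : ι → ℝ) : wsq P x ≤ lambdaMax P * euclNorm x ^ 2 := by
  have hb : BddAbove (spectrum ℝ P) := by
    rw [hP.isHermitian.spectrum_real_eq_range_eigenvalues]
    exact (Set.finite_range _).bddAbove
  have h : P ≤ algebraMap ℝ _ (lambdaMax P) :=
    le_algebraMap_of_spectrum_le (fun r hr => le_csSup hb hr) hP.isHermitian
  simpa only [wsq_algebraMap] using wsq_mono h x

theorem exists_pos_le_of_forall_pos {ι : Type*} [Finite ι] (f : ι → ℝ) (hf : ∀ i, 0 < f i) :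
    ∃ c, 0 < c ∧ ∀ i, c ≤ f i := by
  cases isEmpty_or_nonempty ι
  · exact ⟨1, one_pos, fun i => isEmptyElim i⟩
  · obtain ⟨i, hi⟩ := Finite.exists_min f
    exact ⟨f i, hf i, hi⟩

theorem exists_pos_mul_le_wsq {ι : Type*} [Fintype ι] [DecidableEq ι] {P : Matrix ι ι ℝ}
    (hP : P.PosDef) : ∃ c, 0 < c ∧ ∀ x : ι → ℝ, c * euclNorm x ^ 2 ≤ wsq P x := by
  obtain ⟨c, hc, h⟩ := exists_pos_le_of_forall_pos _ hP.eigenvalues_pos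
  refine ⟨c, hc, fun x => ?_⟩
  have h : algebraMap ℝ _ c ≤ P := by
    refine algebraMap_le_of_le_spectrum (fun r hr => ?_) hP.isHermitian
    rw [hP.isHermitian.spectrum_real_eq_range_eigenvalues] at hr
    obtain ⟨i, rfl⟩ := hr
    exact h i
  simpa only [wsq_algebraMap] using wsq_mono h x

/-- Factoring P = BᵀB turns the weighted norm into the Euclidean norm of Bx. -/
theorem wnorm_add_le {ι : Type*} [Fintype ι] {P : Matrix ι ι ℝ} (hP : P.PosDef) (x y : ι → ℝ) :
    wnorm P (x + y) ≤ wnorm P x + wnorm P y := by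
  classical
  obtain ⟨B, hB⟩ := CStarAlgebra.nonneg_iff_eq_star_mul_self.1 hP.posSemidef.nonneg
  have h : ∀ z, wnorm P z = euclNorm (B *ᵥ z) := fun z => by
    have h0 : 0 ≤ euclNorm (B *ᵥ z) := norm_nonneg _
    rw [wnorm, ← Real.sqrt_sq h0, ← wsq_one, wsq, wsq, hB,
      one_mulVec, ← mulVec_mulVec, dotProduct_mulVec, star_eq_conjTranspose,
      conjTranspose_eq_transpose_of_trivial, vecMul_transpose]
  simp only [h, mulVec_add]
  exact norm_add_le (WithLp.toLp 2 (B *ᵥ x) : EuclideanSpace ℝ ι) (WithLp.toLp 2 (B *ᵥ y))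

theorem wnorm_nonneg {ι : Type*} [Fintype ι] (P : Matrix ι ι ℝ) (x : ι → ℝ) : 0 ≤ wnorm P x :=
  Real.sqrt_nonneg _

theorem wnorm_sq {ι : Type*} [Fintype ι] {P : Matrix ι ι ℝ} (hP : P.PosDef) (x : ι → ℝ) :
    wnorm P x ^ 2 = wsq P x :=
  Real.sq_sqrt (wsq_nonneg hP x)

theorem wnorm_le_of_sub_le {ι : Type*} [Fintype ι] {P : Matrix ι ι ℝ} (hP : P.PosDef)
    {x y : ι → ℝ} {b : ℝ} (h : wnorm P (x - y) ≤ b) : wnorm P x ≤ wnorm P y + b := by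
  have := wnorm_add_le hP (x - y) y
  rw [sub_add_cancel] at this
  linarith

theorem sq_le_young {ε a b c : ℝ} (hε : 0 < ε) (hc : 0 ≤ c) (h : c ≤ a + b) :
    c ^ 2 ≤ (1 + ε) * a ^ 2 + (1 + ε⁻¹) * b ^ 2 := by
  have h1 : c ^ 2 ≤ (a + b) ^ 2 := pow_le_pow_left₀ hc h 2
  have h2 : (1 + ε) * a ^ 2 + (1 + ε⁻¹) * b ^ 2 - (a + b) ^ 2 = ε⁻¹ * (ε * a - b) ^ 2 := by
    field_simp
    ring
  have h3 : 0 ≤ ε⁻¹ * (ε * a - b) ^ 2 := by positivity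
  linarith

/-- Separates the perturbation from the cost: the mixed term is traded for an arbitrarily small
relative inflation ε. -/
theorem wsq_le_young {ι : Type*} [Fintype ι] {P : Matrix ι ι ℝ} (hP : P.PosDef)
    {x y : ι → ℝ} {b ε : ℝ} (hε : 0 < ε) (h : wnorm P (x - y) ≤ b) :
    wsq P x ≤ (1 + ε) * wsq P y + (1 + ε⁻¹) * b ^ 2 := by
  rw [← wnorm_sq hP, ← wnorm_sq hP]
  exact sq_le_young hε (wnorm_nonneg _ _) (wnorm_le_of_sub_le hP h)

end MatrixOrder

/-! ### Trajectories and extended states -/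

namespace Network

variable {M n m p : ℕ} (S : Network M n m p)

variable {S} in
theorem IsLocalTraj.mono {i : Fin M} {a b a' b' : ℤ} {u : ℤ → Fin m → ℝ} {v : ℤ → S.NIdx i → ℝ}
    {y : ℤ → Fin p → ℝ} (h : S.IsLocalTraj i a b u v y) (ha : a ≤ a') (hb : b' ≤ b) :
    S.IsLocalTraj i a' b' u v y := by
  obtain ⟨x, hx⟩ := h
  exact ⟨x, fun k h1 h2 => hx k (ha.trans h1) (h2.trans hb)⟩

theorem ext_congr (i : Fin M) {u u' : ℤ → Fin m → ℝ} {v v' : ℤ → S.NIdx i → ℝ}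
    {y y' : ℤ → Fin p → ℝ} {a b a' b' : ℤ}
    (hu : ∀ k : ℤ, 0 ≤ k → k < n → u (a + k) = u' (a' + k))
    (hv : ∀ k : ℤ, 0 ≤ k → k < n → v (b + k) = v' (b' + k))
    (hy : ∀ k : ℤ, 0 ≤ k → k < n → y (a + k) = y' (a' + k)) :
    S.ext i u v y a b = S.ext i u' v' y' a' b' := by
  funext q
  rcases q with ⟨k, q⟩ | ⟨k, q⟩ | ⟨k, q⟩
  · exact congrFun (hu k (by omega) (by omega)) q
  · exact congrFun (hv k (by omega) (by omega)) q
  · exact congrFun (hy k (by omega) (by omega)) q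

theorem shiftIn_window {κ : Type*} (w : ℤ → κ → ℝ) (a : ℤ) (n : ℕ) :
    shiftIn (window w a n) (w (a + n)) = window w (a + 1) n := by
  funext q
  obtain ⟨k, q⟩ := q
  by_cases h : (k : ℕ) + 1 < n
  · simp only [shiftIn, window, h, dif_pos]
    push_cast
    rw [add_assoc, add_comm (1 : ℤ)]
  · simp only [shiftIn, window, h, dif_neg, not_false_eq_true]
    rw [show a + 1 + ((k : ℕ) : ℤ) = a + n by have := k.2; omega]

theorem extNext_ext (i : Fin M) (Ct : Matrix (Fin p) (S.Ext i) ℝ) (u : ℤ → Fin m → ℝ)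
    (v : ℤ → S.NIdx i → ℝ) (y : ℤ → Fin p → ℝ) (a b : ℤ)
    (hy : y (a + n) = S.extOut i Ct (S.ext i u v y a b) (u (a + n))) :
    S.extNext i Ct (S.ext i u v y a b) (u (a + n)) (v (b + n)) =
      S.ext i u v y (a + 1) (b + 1) := by
  rw [extNext, ← hy]
  simp only [ext, Sum.elim_inl, Sum.elim_inr]
  rw [← shiftIn_window u, ← shiftIn_window v, ← shiftIn_window y]

variable {S} in
theorem IsLocalTraj.output_eq {i : Fin M} {Ct : Matrix (Fin p) (S.Ext i) ℝ}
    (hCt : S.IsExtOutputMat i Ct) {b : ℤ} {u : ℤ → Fin m → ℝ} {v : ℤ → S.NIdx i → ℝ}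
    {y : ℤ → Fin p → ℝ} (h : S.IsLocalTraj i (-n) b u v y) {t : ℤ} (h0 : 0 ≤ t) (ht : t ≤ b) :
    y t = S.extOut i Ct (S.ext i u v y (t - n) (t - n)) (u t) :=
  hCt u v y t (h.mono (by omega) ht)

variable {S} in
/-- The output of a trajectory is determined by the inputs and the past outputs. -/
theorem IsLocalTraj.output_unique {i : Fin M} {Ct : Matrix (Fin p) (S.Ext i) ℝ}
    (hCt : S.IsExtOutputMat i Ct) {b : ℤ} {u u' : ℤ → Fin m → ℝ} {v v' : ℤ → S.NIdx i → ℝ}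
    {y y' : ℤ → Fin p → ℝ} (h : S.IsLocalTraj i (-n) b u v y)
    (h' : S.IsLocalTraj i (-n) b u' v' y')
    (hu : ∀ k : ℤ, -n ≤ k → k ≤ b → u k = u' k) (hv : ∀ k : ℤ, -n ≤ k → k < b → v k = v' k)
    (hy : ∀ k : ℤ, -n ≤ k → k ≤ -1 → y k = y' k) :
    ∀ k : ℤ, -n ≤ k → k ≤ b → y k = y' k := by
  -- The extended state at time k uses the n previous outputs, so the induction must carry agreement
  -- at all earlier times.
  have key : ∀ N : ℕ, ∀ k : ℤ, -n ≤ k → k < N → k ≤ b → y k = y' k := by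
    intro N
    induction N with
    | zero => exact fun k h1 h2 _ => hy k h1 (by push_cast at h2; omega)
    | succ N ih =>
      intro k h1 h2 h3
      by_cases hk : k < N
      · exact ih k h1 hk h3
      have hkN : k = N := by push_cast at h2; omega
      subst hkN
      rw [h.output_eq hCt (by omega) h3, h'.output_eq hCt (by omega) h3, hu _ h1 h3]
      congr 1
      exact S.ext_congr i (fun j _ _ => hu _ (by omega) (by omega))
        (fun j _ _ => hv _ (by omega) (by omega)) (fun j _ _ => ih _ (by omega) (by omega) (by omega))
  exact fun k h1 h2 => key (k.toNat + 1) k h1 (by push_cast; omega) h2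

variable {S} in
/-- Linear combinations of windows of a trajectory are trajectories. -/
theorem IsLocalTraj.of_hankel {i : Fin M} {N T K : ℕ} {ud : ℤ → Fin m → ℝ}
    {vd : ℤ → S.NIdx i → ℝ} {yd : ℤ → Fin p → ℝ}
    (hd : S.IsLocalTraj i 0 ((N : ℤ) - 1) ud vd yd) (hK : K ≤ N + 1 - T) (α : Fin K → ℝ)
    {c : ℤ} {u : ℤ → Fin m → ℝ} {v : ℤ → S.NIdx i → ℝ} {y : ℤ → Fin p → ℝ}
    (hu : hankel ud 0 T K *ᵥ α = window u c T)
    (hv : hankel vd 0 (T - 1) K *ᵥ α = window v c (T - 1))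
    (hy : hankel yd 0 T K *ᵥ α = window y c T) :
    S.IsLocalTraj i c (c + T - 1) u v y := by
  obtain ⟨xd, hxd⟩ := hd
  have rep : ∀ {ι : Type} (d w : ℤ → ι → ℝ) (T' : ℕ),
      hankel d 0 T' K *ᵥ α = window w c T' → ∀ j : ℕ, j < T' →
      w (c + j) = ∑ s : Fin K, α s • d (j + (s : ℕ)) := by
    intro ι d w T' h j hj
    funext q
    have := congrFun h (⟨j, hj⟩, q)
    simp only [mulVec, dotProduct, hankel, of_apply, window, zero_add] at this
    rw [← this, Finset.sum_apply]
    exact Finset.sum_congr rfl fun s _ => mul_comm _ _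
  -- The same combination of the data states serves as state. At time c + T the dynamics themselves
  -- define it, because the equations for `v` have only T - 1 block rows and do not represent its
  -- last value.
  let X : ℕ → Fin n → ℝ := fun j => ∑ s : Fin K, α s • xd (j + (s : ℕ))
  refine ⟨fun k => if k < c + T then X (k - c).toNat else
    S.A i *ᵥ X (T - 1) + S.B i *ᵥ u (k - 1) + S.Bnbr i *ᵥ v (k - 1), fun k h1 h2 => ?_⟩
  obtain ⟨j, rfl⟩ : ∃ j : ℕ, k = c + j := ⟨(k - c).toNat, by omega⟩
  have hj : j < T := by omega
  have hdata : ∀ s : Fin K, (0 : ℤ) ≤ j + (s : ℕ) ∧ (j + (s : ℕ) : ℤ) ≤ N - 1 := fun s => by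
    have := s.2
    omega
  have e0 : (c + (j : ℤ) - c).toNat = j := by omega
  have e1 : (c + (j : ℤ) + 1 - c).toNat = j + 1 := by omega
  simp only [show c + (j : ℤ) < c + T by omega, if_true, e0, e1]
  constructor
  · split_ifs with hlt
    · have hv' := rep vd v _ hv j (by omega)
      rw [rep ud u _ hu j hj, hv']
      simp only [X, mulVec_sum, mulVec_smul, ← Finset.sum_add_distrib, ← smul_add]
      refine Finset.sum_congr rfl fun s _ => ?_
      rw [← (hxd _ (hdata s).1 (hdata s).2).1]
      congr 2
      push_cast
      ring
    · obtain rfl : j = T - 1 := by omega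
      simp
  · rw [rep ud u _ hu j hj, rep yd y _ hy j hj]
    simp only [X, mulVec_sum, mulVec_smul, ← Finset.sum_add_distrib, ← smul_add]
    exact Finset.sum_congr rfl fun s _ => by rw [← (hxd _ (hdata s).1 (hdata s).2).2]

end Network

/-! ### Data-driven simulation and predictions as trajectories -/

namespace Scheme

variable {M n m p : ℕ} {S : Network M n m p} {Z : Scheme S}

theorem apply_of_window_eq {κ : Type*} {w w' : ℤ → κ → ℝ} {a b : ℤ} {T : ℕ}
    (h : window w a T = window w' b T) {k : ℤ} (h0 : 0 ≤ k) (hT : k < T) :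
    w (a + k) = w' (b + k) := by
  lift k to ℕ using h0
  funext q
  exact congrFun h (⟨k, by omega⟩, q)

theorem window_congr {κ : Type*} {w w' : ℤ → κ → ℝ} {a b : ℤ} {T : ℕ}
    (h : ∀ k : ℤ, 0 ≤ k → k < T → w (a + k) = w' (b + k)) : window w a T = window w' b T := by
  funext q
  have := q.1.2
  exact congrFun (h _ (by omega) (by omega)) q.2

/-- The Hankel equations of a data-driven simulation, with past and future outputs stacked. -/
theorem IsSim.exists_hankel {i : Fin M} {ℓ : ℕ} {u : ℤ → Fin m → ℝ} {v : ℤ → S.NIdx i → ℝ}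
    {y : ℤ → Fin p → ℝ} (h : Z.IsSim i ℓ u v y) :
    ∃ α : Fin (Z.N + 1 - (ℓ + n)) → ℝ,
      hankel (Z.ud i) 0 (ℓ + n) _ *ᵥ α = window u (-n) (ℓ + n) ∧
      hankel (Z.vd i) 0 (ℓ + n - 1) _ *ᵥ α = window v (-n) (ℓ + n - 1) ∧
      hankel (Z.yd i) 0 (ℓ + n) _ *ᵥ α = window y (-n) (ℓ + n) := by
  obtain ⟨α, hu, hv, hp, hf⟩ := h
  refine ⟨α, hu, hv, ?_⟩
  funext q
  obtain ⟨⟨k, hk⟩, q⟩ := q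
  by_cases hkn : k < n
  · exact congrFun hp (⟨k, hkn⟩, q)
  · have := congrFun hf (⟨k - n, by omega⟩, q)
    simp only [mulVec, dotProduct, hankel, of_apply, window] at this ⊢
    rw [show (-(n : ℤ) + k) = 0 + ((k - n : ℕ) : ℤ) by omega, ← this]
    refine Finset.sum_congr rfl fun s _ => ?_
    rw [show (n : ℤ) + ((k - n : ℕ) : ℤ) = 0 + k by omega]

theorem IsSim.isLocalTraj (hd : Z.DataAssumption) {i : Fin M} {ℓ : ℕ} {u : ℤ → Fin m → ℝ}
    {v : ℤ → S.NIdx i → ℝ} {y : ℤ → Fin p → ℝ} (h : Z.IsSim i ℓ u v y) :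
    S.IsLocalTraj i (-n) (ℓ - 1) u v y := by
  obtain ⟨α, hu, hv, hy⟩ := h.exists_hankel
  exact (Network.IsLocalTraj.of_hankel (hd.traj i) le_rfl α hu hv hy).mono le_rfl
    (by push_cast; omega)

section Feasible

variable {Ωi : ℝ} {e : Execution M m p} {t : ℤ} {i : Fin M} {α : Fin (Z.N + 1 - (Z.L + n)) → ℝ}
  {u : ℤ → Fin m → ℝ} {y : ℤ → Fin p → ℝ}

theorem Feasible.isLocalTraj (hd : Z.DataAssumption) (h : Z.Feasible Ωi e t i α u y) :
    S.IsLocalTraj i (-n) (Z.L - 1) u (fun k => comm S e (t - 1) i (k + 1)) y := by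
  refine (Network.IsLocalTraj.of_hankel (hd.traj i) le_rfl α h.hankel_u ?_ h.hankel_y).mono le_rfl
    (by push_cast; omega)
  rw [h.hankel_v]
  exact window_congr fun k _ _ => by rw [add_right_comm]

theorem Feasible.past_u (h : Z.Feasible Ωi e t i α u y) {k : ℤ} (h0 : -n ≤ k) (h1 : k ≤ -1) :
    u k = e.u i (t + k) := by
  have := apply_of_window_eq h.init_u (k := k + n) (by omega) (by omega)
  rwa [show -(n : ℤ) + (k + n) = k by ring, show t - n + (k + n) = t + k by ring] at this

theorem Feasible.past_y (h : Z.Feasible Ωi e t i α u y) {k : ℤ} (h0 : -n ≤ k) (h1 : k ≤ -1) :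
    y k = e.y i (t + k) := by
  have := apply_of_window_eq h.init_y (k := k + n) (by omega) (by omega)
  rwa [show -(n : ℤ) + (k + n) = k by ring, show t - n + (k + n) = t + k by ring] at this

end Feasible

/-- Index k at time t is index k + 1 in what was communicated at t - 1; shifting the neighbours'
signal puts all three registers on one clock. -/
theorem predTerminal_eq (Z : Scheme S) (e : Execution M m p) (t : ℤ) (i : Fin M)
    (u : ℤ → Fin m → ℝ) (y : ℤ → Fin p → ℝ) :
    Z.predTerminal e t i u y =
      S.ext i u (fun k => comm S e (t - 1) i (k + 1)) y (Z.L - n) (Z.L - n) :=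
  S.ext_congr i (fun _ _ _ => rfl) (fun k _ _ => by rw [add_right_comm]) fun _ _ _ => rfl

/-! ### The shifted candidate: feasibility and cost -/

section Step

variable {Ω : Fin M → ℝ} {e : Execution M m p} {t : ℤ}
  {Ct : (i : Fin M) → Matrix (Fin p) (S.Ext i) ℝ}

/-- The simulated extension of the optimal output is the terminal output of the extended-state
system. -/
theorem Step.extended_output (hd : Z.DataAssumption) (hCt : ∀ i, S.IsExtOutputMat i (Ct i))
    (h : Z.Step Ω e t) (i : Fin M) :
    e.ys t i Z.L = S.extOut i (Ct i) (Z.predTerminal e t i (e.us t i) (e.ys t i))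
      (Z.κ i (Z.predTerminal e t i (e.us t i) (e.ys t i))) := by
  obtain ⟨α, hf⟩ := (h.optimal i).1
  obtain ⟨y, hsim, hpast, hL⟩ := h.extend_y i
  have htraj := hsim.isLocalTraj hd
  -- Simulation and optimal prediction share inputs, neighbours' outputs and past outputs, so they
  -- agree up to L - 1; the terminal state can be read off either.
  have heq := (htraj.mono (b' := Z.L - 1) le_rfl (by push_cast; omega)).output_unique (hCt i)
    (hf.isLocalTraj hd) (fun _ _ _ => rfl) (fun _ _ _ => rfl) hpast
  rw [hL, htraj.output_eq (hCt i) (by omega) (by push_cast; omega), ← h.extend_u i,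
    predTerminal_eq]
  congr 1
  exact S.ext_congr i (fun _ _ _ => rfl) (fun _ _ _ => rfl)
    fun k _ _ => heq _ (by omega) (by omega)

theorem Step.cand_isLocalTraj (hd : Z.DataAssumption) (h : Z.Step Ω e t) (i : Fin M) :
    S.IsLocalTraj i (-n) (Z.L - 1) (e.uh (t + 1) i) (fun k => comm S e t i (k + 1))
      (e.yh (t + 1) i) :=
  (h.cand_y i).isLocalTraj hd

theorem candState_eq (e : Execution M m p) (t : ℤ) (i : Fin M) :
    Z.candState e (t + 1) i = S.ext i (e.uh (t + 1) i) (fun k => comm S e t i (k + 1))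
      (e.yh (t + 1) i) (Z.L - 1 - n) (Z.L - 1 - n) :=
  S.ext_congr i (fun k _ _ => by rw [sub_right_comm])
    (fun k _ _ => by rw [add_sub_cancel_right]; congr 1; ring)
    fun k _ _ => by rw [sub_right_comm]

theorem Step.predTerminal_cand (hd : Z.DataAssumption) (hCt : ∀ i, S.IsExtOutputMat i (Ct i))
    (hL : 1 ≤ Z.L) (h : Z.Step Ω e t) (i : Fin M) :
    Z.predTerminal e (t + 1) i (e.uh (t + 1) i) (e.yh (t + 1) i) =
      S.extNext i (Ct i) (Z.candState e (t + 1) i) (Z.κ i (Z.candState e (t + 1) i))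
        (S.nbrVec i fun j => e.ys t j Z.L) := by
  have hy := (h.cand_isLocalTraj hd i).output_eq (hCt i) (t := Z.L - 1) (by omega) le_rfl
  have := S.extNext_ext i (Ct i) (e.uh (t + 1) i) (fun k => comm S e t i (k + 1))
    (e.yh (t + 1) i) (Z.L - 1 - n) (Z.L - 1 - n) (by rwa [sub_add_cancel])
  rw [← candState_eq, sub_add_cancel, h.cand_u_last i] at this
  simp only [sub_add_cancel] at this
  refine Eq.trans ?_ this.symm
  rw [predTerminal_eq, add_sub_cancel_right, show (Z.L : ℤ) - 1 - n + 1 = Z.L - n by ring]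

theorem Step.cand_last_output (hd : Z.DataAssumption) (hCt : ∀ i, S.IsExtOutputMat i (Ct i))
    (hL : 1 ≤ Z.L) (h : Z.Step Ω e t) (i : Fin M) :
    e.yh (t + 1) i (Z.L - 1) = S.extOut i (Ct i) (Z.candState e (t + 1) i)
      (Z.κ i (Z.candState e (t + 1) i)) := by
  rw [(h.cand_isLocalTraj hd i).output_eq (hCt i) (t := Z.L - 1) (by omega) le_rfl,
    ← candState_eq, h.cand_u_last i]

theorem terminalSet_mono (i : Fin M) {a b : ℝ} (h : a ≤ b) :
    Z.terminalSet i a ⊆ Z.terminalSet i b :=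
  fun _ hξ => le_trans hξ h

/-- The neighbours' communicated outputs at step L come from their old terminal predictions, not
from their new candidates, so only component i of the state vector is replaced by its candidate. -/
theorem Step.cand_decrease (hd : Z.DataAssumption) (hCt : ∀ i, S.IsExtOutputMat i (Ct i))
    (hL : 1 ≤ Z.L) {η : Fin M → ℝ} (hterm : Z.TerminalAssumption Ct η) (hθ : ∀ i, Z.θ i < 1)
    (h : Z.Step Ω e t) {i : Fin M} (hmem : Z.candState e (t + 1) i ∈ Z.terminalSet i (Z.ε i)) :
    wsq (Z.P i) (Z.predTerminal e (t + 1) i (e.uh (t + 1) i) (e.yh (t + 1) i))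
      + wsq (Z.Q i) (e.yh (t + 1) i (Z.L - 1)) + wsq (Z.R i) (e.uh (t + 1) i (Z.L - 1))
      ≤ wsq (Z.P i) (Z.candState e (t + 1) i)
        - η i * euclNorm (Z.candState e (t + 1) i) ^ 2 := by
  have hpred : ∀ j, Z.predTerminal e t j (e.us t j) (e.ys t j) ∈ Z.terminalSet j (Z.ε j) := by
    intro j
    obtain ⟨α, hf⟩ := (h.optimal j).1
    refine terminalSet_mono j ?_ hf.terminal
    nlinarith [hθ j, hterm.ε_pos j]
  have hdec := hterm.decrease (Function.update
    (fun j => Z.predTerminal e t j (e.us t j) (e.ys t j)) i (Z.candState e (t + 1) i))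
    (fun j => by
      by_cases hj : j = i
      · subst hj
        simpa using hmem
      · simpa [Function.update_of_ne hj] using hpred j) i
  have hv : (S.nbrVec i fun j => S.extOut j (Ct j) (Function.update
      (fun j => Z.predTerminal e t j (e.us t j) (e.ys t j)) i (Z.candState e (t + 1) i) j)
      (Z.κ j (Function.update (fun j => Z.predTerminal e t j (e.us t j) (e.ys t j)) i
        (Z.candState e (t + 1) i) j))) = S.nbrVec i fun j => e.ys t j Z.L := by
    -- Replacing component i leaves the neighbours' outputs untouched, since i is not in `nbr i`.
    funext q
    have hq : q.1.1 ≠ i := by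
      intro hq
      have h1 := q.1.2
      rw [hq] at h1
      exact S.self_notMem i h1
    simp only [Network.nbrVec]
    rw [Function.update_of_ne hq, h.extended_output hd hCt]
  rw [hv, Function.update_self, ← h.predTerminal_cand hd hCt hL, ← h.cand_last_output hd hCt hL,
    ← h.cand_u_last] at hdec
  linarith

/-- Triangle inequality in the P-norm: the tightening by θ leaves a margin √ε - √(θε) for the
deviation. -/
theorem Step.candState_mem {η : Fin M → ℝ} (hterm : Z.TerminalAssumption Ct η)
    (h : Z.Step Ω e t) {i : Fin M} {s : ℝ}
    (hdev : wnorm (Z.P i) (Z.candState e (t + 1) i - Z.predTerminal e t i (e.us t i) (e.ys t i))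
      ≤ s) (hs : s ≤ √(Z.ε i) - √(Z.θ i * Z.ε i)) :
    Z.candState e (t + 1) i ∈ Z.terminalSet i (Z.ε i) := by
  obtain ⟨α, hf⟩ := (h.optimal i).1
  have h1 := wnorm_le_of_sub_le (hterm.posDef i) hdev
  have h2 : wnorm (Z.P i) (Z.predTerminal e t i (e.us t i) (e.ys t i)) ≤ √(Z.θ i * Z.ε i) :=
    Real.sqrt_le_sqrt hf.terminal
  exact (Real.sqrt_le_sqrt_iff (hterm.ε_pos i).le).1
    (show wnorm (Z.P i) (Z.candState e (t + 1) i) ≤ √(Z.ε i) by linarith)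

theorem wsq_sub_le_of_contraction {ι : Type*} [Fintype ι] [DecidableEq ι] {P : Matrix ι ι ℝ}
    (hP : P.PosDef) {η θ : ℝ} (hη : 0 ≤ η) (hθ : θ < 1) (h : 1 - η * (lambdaMax P)⁻¹ ≤ θ)
    (x : ι → ℝ) : wsq P x - η * euclNorm x ^ 2 ≤ θ * wsq P x := by
  have h1 := wsq_le_lambdaMax hP x
  -- A nonpositive value, such as the default `sSup ∅ = 0` for an empty index type, would force 1 ≤
  -- θ.
  have hpos : 0 < lambdaMax P := by
    by_contra hneg
    have : (lambdaMax P)⁻¹ ≤ 0 := inv_nonpos.2 (not_lt.1 hneg)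
    nlinarith
  have h2 : (lambdaMax P)⁻¹ * wsq P x ≤ euclNorm x ^ 2 := by
    rw [inv_mul_le_iff₀ hpos]
    exact h1
  have h3 := mul_le_mul_of_nonneg_left h2 hη
  have h4 := mul_le_mul_of_nonneg_right h (wsq_nonneg hP x)
  linarith

/-- The candidate is feasible at the next time. -/
theorem Step.cand_feasible (hd : Z.DataAssumption) (hCt : ∀ i, S.IsExtOutputMat i (Ct i))
    (hL : 1 ≤ Z.L) (hQ : ∀ i, (Z.Q i).PosDef) (hR : ∀ i, (Z.R i).PosDef)
    {η : Fin M → ℝ} (hterm : Z.TerminalAssumption Ct η)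
    (hθ : ∀ i, 0 < Z.θ i ∧ Z.θ i < 1 ∧ 1 - η i * (lambdaMax (Z.P i))⁻¹ ≤ Z.θ i)
    (h : Z.Step Ω e t) {i : Fin M} (hΩ : 0 ≤ Ω i)
    (hmem : Z.candState e (t + 1) i ∈ Z.terminalSet i (Z.ε i)) :
    ∃ α, Z.Feasible (Ω i) e (t + 1) i α (e.uh (t + 1) i) (e.yh (t + 1) i) := by
  obtain ⟨α₀, hf⟩ := (h.optimal i).1
  obtain ⟨α, hu, hv, hy⟩ := (h.cand_y i).exists_hankel
  refine ⟨α, hu, ?_, hy, ?_, ?_, ?_, ?_, ?_, ?_⟩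
  · rw [hv, add_sub_cancel_right]
    exact window_congr fun k _ _ => by rw [add_right_comm]
  · refine window_congr fun k h0 hk => ?_
    rw [h.cand_u i _ (by omega) (by omega)]
    -- The newest past entry is the input just applied, the first optimal one; older entries were
    -- already past at time t.
    by_cases hkn : k = n - 1
    · subst hkn
      rw [show -(n : ℤ) + (n - 1) + 1 = 0 by ring, ← h.apply i]
      congr 1
      ring
    · rw [hf.past_u (by omega) (by omega)]
      congr 1
      ring
  · refine window_congr fun k h0 hk => ?_
    rw [h.cand_y_past i _ (by omega) (by omega)]
    congr 1
    ring
  · intro k h0 hk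
    by_cases hkL : k = Z.L - 1
    · subst hkL
      rw [h.cand_u_last i]
      exact hterm.mem i _ hmem
    · rw [h.cand_u i k (by omega) (by omega)]
      exact hf.input _ (by omega) (by omega)
  · have h1 := h.cand_decrease hd hCt hL hterm (fun i => (hθ i).2.1) hmem
    have h2 := wsq_sub_le_of_contraction (hterm.posDef i) (hterm.η_pos i).le (hθ i).2.1
      (hθ i).2.2 (Z.candState e (t + 1) i)
    have h3 := mul_le_mul_of_nonneg_left (show _ ≤ _ from hmem) (hθ i).1.le
    have h4 := wsq_nonneg (hQ i) (e.yh (t + 1) i (Z.L - 1))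
    have h5 := wsq_nonneg (hR i) (e.uh (t + 1) i (Z.L - 1))
    show wsq _ _ ≤ _
    linarith
  -- For the candidate itself both sides of the consistency constraints differ only by the margin Ω
  -- ≥ 0.
  · intro k _ _
    linarith
  · intro k _ _
    linarith

theorem cost_nonneg (hQ : ∀ i, (Z.Q i).PosDef) (hR : ∀ i, (Z.R i).PosDef)
    (hP : ∀ i, (Z.P i).PosDef) (e : Execution M m p) (t : ℤ) (i : Fin M) (u : ℤ → Fin m → ℝ)
    (y : ℤ → Fin p → ℝ) : 0 ≤ Z.cost e t i u y :=
  add_nonneg (Finset.sum_nonneg fun _ _ => add_nonneg (wsq_nonneg (hQ i) _) (wsq_nonneg (hR i) _))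
    (wsq_nonneg (hP i) _)

/-- Cost of the candidate, compared with the optimal cost one time step earlier. -/
theorem Step.cand_cost_le (hd : Z.DataAssumption) (hCt : ∀ i, S.IsExtOutputMat i (Ct i))
    (hL : 1 ≤ Z.L) (hQ : ∀ i, (Z.Q i).PosDef) (hR : ∀ i, (Z.R i).PosDef)
    {η : Fin M → ℝ} (hterm : Z.TerminalAssumption Ct η) (hθ : ∀ i, Z.θ i < 1)
    (h : Z.Step Ω e t) {i : Fin M}
    (hmem : Z.candState e (t + 1) i ∈ Z.terminalSet i (Z.ε i)) {a b μ : ℝ} (hμ : 0 < μ)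
    (hstate : wnorm (Z.P i)
      (Z.candState e (t + 1) i - Z.predTerminal e t i (e.us t i) (e.ys t i)) ≤ a)
    (houtput : ∀ k : ℤ, 0 ≤ k → k ≤ Z.L - 2 →
      wnorm (Z.Q i) (e.yh (t + 1) i k - e.ys t i (k + 1)) ≤ b) :
    Z.cost e (t + 1) i (e.uh (t + 1) i) (e.yh (t + 1) i)
      ≤ (1 + μ) * Z.cost e t i (e.us t i) (e.ys t i)
        - (wsq (Z.Q i) (e.ys t i 0) + wsq (Z.R i) (e.us t i 0))
        + (1 + μ⁻¹) * (Z.L * b ^ 2 + a ^ 2) := by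
  have hdec := h.cand_decrease hd hCt hL hterm hθ hmem
  have hη := mul_nonneg (hterm.η_pos i).le (sq_nonneg (euclNorm (Z.candState e (t + 1) i)))
  have hst := wsq_le_young (hterm.posDef i) hμ hstate
  have hμ' := inv_pos.2 hμ
  -- The candidate inputs are exactly the shifted optimal ones, so only the output terms pay for the
  -- deviation.
  have hsum : ∑ k ∈ Finset.range (Z.L - 1),
        (wsq (Z.Q i) (e.yh (t + 1) i k) + wsq (Z.R i) (e.uh (t + 1) i k))
      ≤ (1 + μ) * ∑ k ∈ Finset.range (Z.L - 1), (wsq (Z.Q i) (e.ys t i (k + 1 : ℕ))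
          + wsq (Z.R i) (e.us t i (k + 1 : ℕ))) + ((Z.L - 1 : ℕ) : ℝ) * ((1 + μ⁻¹) * b ^ 2) := by
    have hconst : ((Z.L - 1 : ℕ) : ℝ) * ((1 + μ⁻¹) * b ^ 2)
        = ∑ _k ∈ Finset.range (Z.L - 1), (1 + μ⁻¹) * b ^ 2 := by simp
    rw [hconst, Finset.mul_sum, ← Finset.sum_add_distrib]
    refine Finset.sum_le_sum fun k hk => ?_
    rw [Finset.mem_range] at hk
    have h1 := wsq_le_young (hQ i) hμ (houtput k (by omega) (by omega))
    have h2 := mul_nonneg hμ.le (wsq_nonneg (hR i) (e.us t i (k + 1)))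
    rw [h.cand_u i k (by omega) (by omega)]
    push_cast
    linarith
  have hb : ((Z.L - 1 : ℕ) : ℝ) * ((1 + μ⁻¹) * b ^ 2) ≤ Z.L * ((1 + μ⁻¹) * b ^ 2) := by
    gcongr
    omega
  -- The first stage cost leaves the sum, and its inflation by μ is simply discarded.
  have h0 : 0 ≤ μ * (wsq (Z.Q i) (e.ys t i 0) + wsq (Z.R i) (e.us t i 0)) :=
    mul_nonneg hμ.le (add_nonneg (wsq_nonneg (hQ i) _) (wsq_nonneg (hR i) _))
  obtain ⟨l, hl⟩ : ∃ l, Z.L = l + 1 := ⟨Z.L - 1, by omega⟩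
  have hlast : ((Z.L : ℤ) - 1) = (l : ℕ) := by omega
  have hl' : Z.L - 1 = l := by omega
  rw [hl'] at hsum
  rw [hlast] at hdec
  unfold cost
  have e1 : ∑ k ∈ Finset.range Z.L,
      (wsq (Z.Q i) (e.yh (t + 1) i k) + wsq (Z.R i) (e.uh (t + 1) i k)) =
      ∑ k ∈ Finset.range l, (wsq (Z.Q i) (e.yh (t + 1) i k) + wsq (Z.R i) (e.uh (t + 1) i k))
      + (wsq (Z.Q i) (e.yh (t + 1) i l) + wsq (Z.R i) (e.uh (t + 1) i l)) := by
    rw [hl, Finset.sum_range_succ]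
  have e2 : ∑ k ∈ Finset.range Z.L, (wsq (Z.Q i) (e.ys t i k) + wsq (Z.R i) (e.us t i k)) =
      ∑ k ∈ Finset.range l,
        (wsq (Z.Q i) (e.ys t i (k + 1 : ℕ)) + wsq (Z.R i) (e.us t i (k + 1 : ℕ)))
      + (wsq (Z.Q i) (e.ys t i 0) + wsq (Z.R i) (e.us t i 0)) := by
    rw [hl, Finset.sum_range_succ']
    rfl
  rw [e1, e2]
  rw [hl'] at hb
  linarith

end Step

/-- The first predicted outputs are the measured ones. -/
theorem IsExecution.first_output {Ω : Fin M → ℝ} {e : Execution M m p} {T : ℕ}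
    {Ct : (i : Fin M) → Matrix (Fin p) (S.Ext i) ℝ}
    (hd : Z.DataAssumption) (hCt : ∀ i, S.IsExtOutputMat i (Ct i))
    (hL : 1 ≤ Z.L) (h : Z.IsExecution Ω e T) (t : ℕ) (ht : t ≤ T) (i : Fin M) :
    e.ys t i 0 = e.y i t := by
  induction t generalizing i with
  | zero =>
    have hs := h.step 0 le_rfl (by omega)
    obtain ⟨α, hf⟩ := (hs.optimal i).1
    rw [Nat.cast_zero, (hf.isLocalTraj hd).output_eq (hCt i) le_rfl (by omega),
      (h.plant i).output_eq (hCt i) le_rfl (by omega), hs.apply i]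
    congr 1
    refine S.ext_congr i (fun k _ _ => ?_) (fun k _ _ => ?_) (fun k _ _ => ?_)
    · rw [hf.past_u (by omega) (by omega), zero_add]
    -- The trajectory communicated at time -1 is the initial candidate, whose past outputs are the
    -- measured ones.
    · funext q
      obtain ⟨α', hf'⟩ := h.initial.feasible q.1
      show e.ys (0 - 1) q.1 _ q.2 = e.y q.1 _ q.2
      rw [zero_sub, h.initial.comm_y _ _ (by omega) (by omega), hf'.past_y (by omega) (by omega),
        zero_add]
    · rw [hf.past_y (by omega) (by omega), zero_add]
  | succ t ih =>
    have hs := h.step (t + 1 : ℕ) (by omega) (by omega)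
    have hs' := h.step t (by omega) (by omega)
    obtain ⟨α, hf⟩ := (hs.optimal i).1
    rw [(hf.isLocalTraj hd).output_eq (hCt i) le_rfl (by omega),
      (h.plant i).output_eq (hCt i) (by omega) (by omega), hs.apply i]
    congr 1
    refine S.ext_congr i (fun k _ _ => ?_) (fun k _ _ => ?_) (fun k _ _ => ?_)
    · rw [hf.past_u (by omega) (by omega)]
      congr 1
      ring
    · funext q
      obtain ⟨α', hf'⟩ := (hs'.optimal q.1).1
      show e.ys ((t + 1 : ℕ) - 1) q.1 _ q.2 = e.y q.1 _ q.2
      rw [show ((t + 1 : ℕ) : ℤ) - 1 = t by push_cast; ring]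
      -- The newest neighbour output is entry 0 of the previous prediction, covered by the induction
      -- hypothesis for all subsystems; the others are measured past outputs.
      by_cases hk : k = n - 1
      · subst hk
        rw [show (0 : ℤ) - n + (n - 1) + 1 = 0 by ring, ih (by omega)]
        congr 1
        push_cast
        ring
      · rw [hf'.past_y (by omega) (by omega)]
        congr 1
        push_cast
        ring
    · rw [hf.past_y (by omega) (by omega)]
      congr 1
      ring

end Scheme

/-! ### Extended state versus past stage values -/

theorem euclNorm_nonneg {ι : Type*} [Fintype ι] (x : ι → ℝ) : 0 ≤ euclNorm x := norm_nonneg _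

theorem euclNorm_sq {ι : Type*} [Fintype ι] (x : ι → ℝ) : euclNorm x ^ 2 = ∑ i, x i ^ 2 := by
  simp [euclNorm, EuclideanSpace.norm_sq_eq]

/-- `∑ i, ‖u^i_t‖ ^ 2 + ‖y^i_t‖ ^ 2`. -/
noncomputable def Execution.stageSq {M m p : ℕ} (e : Execution M m p) (t : ℤ) : ℝ :=
  ∑ i, (euclNorm (e.u i t) ^ 2 + euclNorm (e.y i t) ^ 2)

/-- Weighted sum of the last `n` values; its increment is `n f(t) - ∑_{j < n} f(t - n + j)`. -/
noncomputable def weightedPast (n : ℕ) (f : ℤ → ℝ) (t : ℤ) : ℝ :=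
  ∑ j ∈ Finset.range n, ((j : ℝ) + 1) * f (t - n + j)

/-- At each step every stored value loses one unit of weight, and the newest enters with weight n.
-/
theorem weightedPast_succ (n : ℕ) (f : ℤ → ℝ) (t : ℤ) :
    weightedPast n f (t + 1)
      = weightedPast n f t + n * f t - ∑ j ∈ Finset.range n, f (t - n + j) := by
  have key : ∀ (g : ℕ → ℝ) (l : ℕ), ∑ j ∈ Finset.range l, ((j : ℝ) + 1) * g (j + 1)
      = ∑ j ∈ Finset.range l, ((j : ℝ) + 1) * g j + l * g l - ∑ j ∈ Finset.range l, g j := by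
    intro g l
    induction l with
    | zero => simp
    | succ l ih =>
      simp only [Finset.sum_range_succ, ih]
      push_cast
      ring
  have := key (fun j => f (t - n + j)) n
  rw [sub_add_cancel] at this
  rw [weightedPast, weightedPast, ← this]
  refine Finset.sum_congr rfl fun j _ => ?_
  congr 2
  push_cast
  ring

theorem sum_le_weightedPast (n : ℕ) {f : ℤ → ℝ} (hf : ∀ t, 0 ≤ f t) (t : ℤ) :
    ∑ j ∈ Finset.range n, f (t - n + j) ≤ weightedPast n f t :=
  Finset.sum_le_sum fun j _ => le_mul_of_one_le_left (hf _) (by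
    have : (0 : ℝ) ≤ j := j.cast_nonneg
    linarith)

theorem weightedPast_le (n : ℕ) {f : ℤ → ℝ} (hf : ∀ t, 0 ≤ f t) (t : ℤ) :
    weightedPast n f t ≤ n * ∑ j ∈ Finset.range n, f (t - n + j) := by
  rw [Finset.mul_sum]
  refine Finset.sum_le_sum fun j hj => mul_le_mul_of_nonneg_right ?_ (hf _)
  exact_mod_cast Finset.mem_range.1 hj

theorem Execution.stageSq_nonneg {M m p : ℕ} (e : Execution M m p) (t : ℤ) : 0 ≤ e.stageSq t :=
  Finset.sum_nonneg fun _ _ => by positivity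

theorem euclNorm_globalExt_sq {M n m p : ℕ} (S : Network M n m p) (e : Execution M m p) (t : ℤ) :
    euclNorm (globalExt S e t) ^ 2 = ∑ j ∈ Finset.range n,
      (e.stageSq (t - n + j) + ∑ i, ∑ l ∈ S.nbr i, euclNorm (e.y l (t - n + j)) ^ 2) := by
  rw [euclNorm_sq, Fintype.sum_sigma, Finset.sum_range, Finset.sum_add_distrib]
  simp only [Execution.stageSq]
  rw [Finset.sum_comm, Finset.sum_comm (s := Finset.univ (α := Fin n)), ← Finset.sum_add_distrib]
  refine Finset.sum_congr rfl fun i _ => ?_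
  simp only [Fintype.sum_sum_type, globalExt, Network.ext, Sum.elim_inl, Sum.elim_inr, window,
    Network.nbrVec, Fintype.sum_prod_type, euclNorm_sq, Finset.sum_add_distrib]
  have : ∀ x : Fin n, ∑ l ∈ S.nbr i, ∑ a, e.y l (t - n + (x : ℕ)) a ^ 2
      = ∑ l : {j // j ∈ S.nbr i}, ∑ a, e.y l (t - n + (x : ℕ)) a ^ 2 := fun x =>
    (Finset.sum_coe_sort (S.nbr i) fun l => ∑ a, e.y l (t - n + (x : ℕ)) a ^ 2).symm
  simp only [this]
  ring

theorem sum_stageSq_le {M n m p : ℕ} (S : Network M n m p) (e : Execution M m p) (t : ℤ) :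
    ∑ j ∈ Finset.range n, e.stageSq (t - n + j) ≤ euclNorm (globalExt S e t) ^ 2 := by
  rw [euclNorm_globalExt_sq]
  exact Finset.sum_le_sum fun j _ => le_add_of_nonneg_right
    (Finset.sum_nonneg fun _ _ => Finset.sum_nonneg fun _ _ => sq_nonneg _)

/-- Each output is stored once as a subsystem's own and at most M times as a neighbour's. -/
theorem euclNorm_globalExt_sq_le {M n m p : ℕ} (S : Network M n m p) (e : Execution M m p)
    (t : ℤ) : euclNorm (globalExt S e t) ^ 2
      ≤ (M + 1) * ∑ j ∈ Finset.range n, e.stageSq (t - n + j) := by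
  rw [euclNorm_globalExt_sq, Finset.mul_sum]
  refine Finset.sum_le_sum fun j _ => ?_
  have h : ∀ i, ∑ l ∈ S.nbr i, euclNorm (e.y l (t - n + j)) ^ 2 ≤ e.stageSq (t - n + j) := by
    intro i
    refine (Finset.sum_le_univ_sum_of_nonneg fun _ => sq_nonneg _).trans ?_
    exact Finset.sum_le_sum fun l _ => le_add_of_nonneg_left (sq_nonneg _)
  have := Finset.sum_le_sum fun i (_ : i ∈ Finset.univ) => h i
  rw [Finset.sum_const, Finset.card_univ, Fintype.card_fin, nsmul_eq_mul] at this
  linarith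

/-! ### Scalar contraction and comparison functions -/

/-- d/ρ is the fixed point of y ↦ (1 - ρ)y + d, and 1 - ρ ≤ exp(-ρ). -/
theorem le_exp_mul_add_of_contraction {Y : ℕ → ℝ} {ρ d : ℝ} {T : ℕ} (h0 : 0 ≤ Y 0) (hρ : 0 < ρ)
    (hρ' : ρ ≤ 1) (hd : 0 ≤ d) (h : ∀ t, t + 1 ≤ T → Y (t + 1) ≤ (1 - ρ) * Y t + d) (t : ℕ)
    (ht : t ≤ T) : Y t ≤ Real.exp (-ρ * t) * Y 0 + d / ρ := by
  induction t with
  | zero => simpa using div_nonneg hd hρ.le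
  | succ t ih =>
    have h1 := mul_le_mul_of_nonneg_left (ih (by omega)) (sub_nonneg.2 hρ')
    have h2 : (1 - ρ) * (d / ρ) + d = d / ρ := by
      field_simp
      ring
    have h3 : 1 - ρ ≤ Real.exp (-ρ) := by
      have := Real.add_one_le_exp (-ρ)
      linarith
    have h4 := mul_le_mul_of_nonneg_right h3 (mul_nonneg (Real.exp_nonneg (-ρ * t)) h0)
    have h5 : Real.exp (-ρ * (t + 1 : ℕ)) = Real.exp (-ρ) * Real.exp (-ρ * t) := by
      rw [← Real.exp_add]
      push_cast
      ring_nf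
    rw [h5]
    linarith [h t ht]

theorem isClassKL_exp {a c : ℝ} (ha : 0 < a) (hc : 0 < c) :
    IsClassKL fun r t => a * r * Real.exp (-c * t) := by
  refine ⟨fun t _ => ⟨by fun_prop, fun x _ y _ hxy => ?_, by simp⟩,
    fun r hr => ⟨by fun_prop, fun x _ y _ hxy => ?_, ?_⟩⟩
  · exact mul_lt_mul_of_pos_right (mul_lt_mul_of_pos_left hxy ha) (Real.exp_pos _)
  · exact mul_lt_mul_of_pos_left (Real.exp_lt_exp.2 (by nlinarith)) (mul_pos ha hr)
  · have : Tendsto (fun t => Real.exp (-c * t)) atTop (𝓝 0) :=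
      Real.tendsto_exp_atBot.comp (tendsto_id.const_mul_atTop_of_neg (neg_neg_of_pos hc))
    simpa using this.const_mul (a * r)

theorem IsClassK.nonneg {σ : ℝ → ℝ} (h : IsClassK σ) {r : ℝ} (hr : 0 ≤ r) : 0 ≤ σ r :=
  h.2.2 ▸ h.2.1.monotoneOn self_mem_Ici hr hr

theorem IsClassK.mono {σ : ℝ → ℝ} (h : IsClassK σ) {r s : ℝ} (hr : 0 ≤ r) (hrs : r ≤ s) :
    σ r ≤ σ s :=
  h.2.1.monotoneOn hr (hr.trans hrs) hrs

/-- The summand r gives strict growth even when c = 0 or the sum is empty. -/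
theorem isClassK_add_sum {ι : Type*} [Fintype ι] {σ : ι → ℝ → ℝ} (h : ∀ i, IsClassK (σ i)) {c : ℝ}
    (hc : 0 ≤ c) : IsClassK fun r => r + c * ∑ i, σ i r := by
  refine ⟨continuousOn_id.add (continuousOn_const.mul
    (continuousOn_finsetSum _ fun i _ => (h i).1)), fun x hx y _ hxy => ?_, by simp [(h _).2.2]⟩
  exact add_lt_add_of_lt_of_le hxy (mul_le_mul_of_nonneg_left
    (Finset.sum_le_sum fun i _ => (h i).mono hx hxy.le) hc)

theorem IsClassK.add {σ τ : ℝ → ℝ} (hσ : IsClassK σ) (hτ : IsClassK τ) :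
    IsClassK fun r => σ r + τ r :=
  ⟨hσ.1.add hτ.1, fun _ hx _ hy hxy => add_lt_add (hσ.2.1 hx hy hxy) (hτ.2.1 hx hy hxy),
    by simp [hσ.2.2, hτ.2.2]⟩

/-- Finitely many class `K` functions are below given positive bounds near zero. -/
theorem exists_pos_forall_classK_le {ι : Type*} [Finite ι] {σ : ι → ℝ → ℝ}
    (h : ∀ i, IsClassK (σ i)) {b : ι → ℝ} (hb : ∀ i, 0 < b i) :
    ∃ r, 0 < r ∧ ∀ i s, 0 ≤ s → s ≤ r → σ i s ≤ b i := by
  have h1 : ∀ i, ∀ᶠ s in 𝓝[≥] (0 : ℝ), σ i s < b i := fun i => by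
    have := (h i).1 0 self_mem_Ici
    rw [ContinuousWithinAt, (h i).2.2] at this
    exact this.eventually_lt_const (hb i)
  obtain ⟨r, hr, hr'⟩ := mem_nhdsGE_iff_exists_Icc_subset.1 (eventually_all.2 h1)
  exact ⟨r, hr, fun i s h0 hs => (hr' ⟨h0, hs⟩ i).le⟩

/-! ### Cost decrease and the input-to-state estimate -/

theorem sqrt_mul_lt_sqrt {θ ε : ℝ} (hε : 0 < ε) (hθ : θ < 1) : 0 < √ε - √(θ * ε) :=
  sub_pos.2 (Real.sqrt_lt_sqrt_iff_of_pos hε |>.2 (by nlinarith))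

/-- Decrease of the sum of the optimal costs along the closed loop. -/
theorem Scheme.IsExecution.optCost_succ_le {M n m p : ℕ} {S : Network M n m p} {Z : Scheme S}
    {Ct : (i : Fin M) → Matrix (Fin p) (S.Ext i) ℝ} {Ω : Fin M → ℝ} {e : Execution M m p} {T : ℕ}
    (hd : Z.DataAssumption) (hCt : ∀ i, S.IsExtOutputMat i (Ct i)) (hL : 1 ≤ Z.L)
    (hQ : ∀ i, (Z.Q i).PosDef) (hR : ∀ i, (Z.R i).PosDef)
    {η : Fin M → ℝ} (hterm : Z.TerminalAssumption Ct η)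
    (hθ : ∀ i, 0 < Z.θ i ∧ Z.θ i < 1 ∧ 1 - η i * (lambdaMax (Z.P i))⁻¹ ≤ Z.θ i)
    (h : Z.IsExecution Ω e T) (hΩ : ∀ i, 0 ≤ Ω i) {σt σp : Fin M → ℝ → ℝ}
    (hdev : Z.DeviationBound σt σp Ω e T)
    (hs : ∀ i, σt i (Ω i) ≤ √(Z.ε i) - √(Z.θ i * Z.ε i)) {c μ : ℝ} (hμ : 0 < μ)
    (hcQ : ∀ i x, c * euclNorm x ^ 2 ≤ wsq (Z.Q i) x)
    (hcR : ∀ i x, c * euclNorm x ^ 2 ≤ wsq (Z.R i) x) {t : ℕ} (ht : t + 1 ≤ T) :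
    Z.optCost e (t + 1) ≤ (1 + μ) * Z.optCost e t - c * e.stageSq t
      + (1 + μ⁻¹) * ∑ i, (Z.L * σp i (Ω i) ^ 2 + σt i (Ω i) ^ 2) := by
  have hst := h.step t (by omega) (by omega)
  have hst' := h.step (t + 1) (by omega) (by omega)
  rw [optCost, optCost, Execution.stageSq, Finset.mul_sum, Finset.mul_sum, Finset.mul_sum,
    ← Finset.sum_sub_distrib, ← Finset.sum_add_distrib]
  refine Finset.sum_le_sum fun i _ => ?_
  have hstate := hdev.state i t (by omega) (by omega)
  have hmem := hst.candState_mem hterm hstate (hs i)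
  obtain ⟨α, hf⟩ := hst.cand_feasible hd hCt hL hQ hR hterm hθ (hΩ i) hmem
  have h1 := (hst'.optimal i).2 _ _ _ hf
  have h2 := hst.cand_cost_le hd hCt hL hQ hR hterm (fun i => (hθ i).2.1) hmem hμ hstate
    (hdev.output i t · (by omega) (by omega))
  have h3 := hcQ i (e.ys t i 0)
  have h4 := hcR i (e.us t i 0)
  -- Turns predicted into measured stage values, so that the decrease is expressed in closed-loop
  -- signals.
  rw [h.first_output hd hCt hL t (by omega)] at h2 h3
  rw [← hst.apply i] at h2 h4
  linarith

theorem Scheme.optCost_nonneg {M n m p : ℕ} {S : Network M n m p} {Z : Scheme S}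
    (hQ : ∀ i, (Z.Q i).PosDef) (hR : ∀ i, (Z.R i).PosDef) (hP : ∀ i, (Z.P i).PosDef)
    (e : Execution M m p) (t : ℤ) : 0 ≤ Z.optCost e t :=
  Finset.sum_nonneg fun i _ => cost_nonneg hQ hR hP e t i _ _

/-- An input-to-state estimate from a cost `V` with `V(t+1) ≤ (1 + μ) V(t) - c f(t) + d` and
`V ≤ b X²`, where `X²` is equivalent to the sum of `f` over the last `n` instants. -/
theorem sq_le_of_cost_decrease {n : ℕ} {X V f : ℤ → ℝ} {a b c d : ℝ} {T : ℕ} (ha : 0 < a)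
    (hb : 0 < b) (hc : 0 < c) (hd : 0 ≤ d) (hf : ∀ t, 0 ≤ f t) (hV : ∀ t, 0 ≤ V t)
    (hX : ∀ t, ∑ j ∈ Finset.range n, f (t - n + j) ≤ X t ^ 2)
    (hX' : ∀ t, X t ^ 2 ≤ a * ∑ j ∈ Finset.range n, f (t - n + j))
    (hVX : ∀ t : ℕ, t ≤ T → V t ≤ b * X t ^ 2) {γ μ b' ρ : ℝ} (hγ : γ = c / (n + 1))
    (hμ : μ = γ / (2 * a * b)) (hb' : b' = b + γ * (n + a⁻¹)) (hρ : ρ = γ / (2 * a * b'))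
    (hdec : ∀ t : ℕ, t + 1 ≤ T → V (t + 1) ≤ (1 + μ) * V t - c * f t + d) (t : ℕ) (ht : t ≤ T) :
    X t ^ 2 ≤ a / γ * (Real.exp (-ρ * t) * (b' * X 0 ^ 2) + d / ρ) := by
  have hγ0 : 0 < γ := hγ ▸ by positivity
  have hμ0 : 0 < μ := hμ ▸ by positivity
  have hb'0 : 0 < b' := hb' ▸ by positivity
  have hρ0 : 0 < ρ := hρ ▸ by positivity
  -- The stage decrease c f pays for the growth γ n f of the weighted past; the denominator n + 1
  -- also admits n = 0.
  have hγn : γ * n ≤ c := by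
    have : γ * (n + 1) = c := by rw [hγ]; field_simp
    nlinarith
  -- The extra γ/a in b' serves only here: it gives a b' ≥ γ, hence ρ ≤ 1/2.
  have hρ1 : ρ ≤ 1 := by
    rw [hρ, div_le_one (by positivity)]
    have h1 : a * b' = a * b + a * (γ * n) + γ := by
      rw [hb']
      field_simp
      ring
    have h2 : 0 ≤ a * b + a * (γ * n) := by positivity
    linarith
  have hY : ∀ s : ℕ, s ≤ T → V s + γ * weightedPast n f s ≤ b' * X s ^ 2 := fun s hs => by
    have h1 := (weightedPast_le n hf s).trans (mul_le_mul_of_nonneg_left (hX s) n.cast_nonneg)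
    have h2 := mul_le_mul_of_nonneg_left h1 hγ0.le
    have h3 : 0 ≤ γ * a⁻¹ * X s ^ 2 := by positivity
    rw [hb']
    linarith [hVX s hs]
  -- The lower bound comes from the weighted past alone; of V only nonnegativity is needed.
  have hY' : ∀ s : ℕ, X s ^ 2 ≤ a / γ * (V s + γ * weightedPast n f s) := fun s => by
    have h1 := mul_le_mul_of_nonneg_left (sum_le_weightedPast n hf s) ha.le
    have h2 : a / γ * (V s + γ * weightedPast n f s)
        = a / γ * V s + a * weightedPast n f s := by
      field_simp
    have h3 : 0 ≤ a / γ * V s := mul_nonneg (by positivity) (hV s)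
    linarith [hX' s]
  have hY0 : 0 ≤ V (0 : ℕ) + γ * weightedPast n f (0 : ℕ) := add_nonneg (hV _)
    (mul_nonneg hγ0.le (Finset.sum_nonneg fun j _ => mul_nonneg (by positivity) (hf _)))
  have key := le_exp_mul_add_of_contraction (Y := fun s : ℕ => V s + γ * weightedPast n f s)
    hY0 hρ0 hρ1 hd (fun s hs => by
      have h1 := hdec s hs
      have h2 := hY s (by omega)
      have h3 := mul_le_mul_of_nonneg_left h2 hρ0.le
      have h4 := mul_le_mul_of_nonneg_left (hVX s (by omega)) hμ0.le
      -- μ and ρ are chosen so that each of the two terms is half of the available decrease γ X²/a.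
      have h5 : μ * (b * X s ^ 2) + ρ * (b' * X s ^ 2) = γ * (a⁻¹ * X s ^ 2) := by
        rw [hμ, hρ]
        field_simp
        ring
      have h6 : a⁻¹ * X s ^ 2 ≤ ∑ j ∈ Finset.range n, f (s - n + j) := by
        rw [inv_mul_le_iff₀ ha]
        exact hX' s
      have h7 := mul_le_mul_of_nonneg_left h6 hγ0.le
      have h8 := mul_le_mul_of_nonneg_right hγn (hf s)
      push_cast
      rw [weightedPast_succ]
      linarith) t ht
  refine (hY' t).trans (mul_le_mul_of_nonneg_left (key.trans ?_) (by positivity))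
  have := mul_le_mul_of_nonneg_left (hY 0 (by omega)) (Real.exp_nonneg (-ρ * t))
  simpa using this

/-! ### Choice of uniform constants and conclusion -/

theorem theorem2 {M n m p : ℕ} (hM : 2 ≤ M) (S : Network M n m p) (Z : Scheme S)
    (hL : 1 ≤ Z.L) (hU : ∀ i, IsCompact (Z.U i))
    (hQ : ∀ i, (Z.Q i).PosDef) (hR : ∀ i, (Z.R i).PosDef)
    (hdata : Z.DataAssumption)
    (Ct : (i : Fin M) → Matrix (Fin p) (S.Ext i) ℝ) (hCt : ∀ i, S.IsExtOutputMat i (Ct i))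
    (η : Fin M → ℝ) (hterm : Z.TerminalAssumption Ct η)
    (hθ : ∀ i, 0 < Z.θ i ∧ Z.θ i < 1 ∧ 1 - η i * (lambdaMax (Z.P i))⁻¹ ≤ Z.θ i)
    (σt σp : Fin M → ℝ → ℝ) (hσt : ∀ i, IsClassK (σt i)) (hσp : ∀ i, IsClassK (σp i))
    (cub : ℝ) (hcub : 0 < cub) :
    ∃ (β : ℝ → ℝ → ℝ) (δ : ℝ → ℝ) (Ωmax : ℝ), IsClassKL β ∧ IsClassK δ ∧ 0 < Ωmax ∧
      ∀ Ω : Fin M → ℝ, (∀ i, 0 ≤ Ω i) → (⨆ i, Ω i) ≤ Ωmax →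
      ∀ (e : Execution M m p) (T : ℕ), Z.IsExecution Ω e T →
        Z.DeviationBound σt σp Ω e T →
        (∀ t : ℕ, t ≤ T → Z.optCost e t ≤ cub * euclNorm (globalExt S e t) ^ 2) →
        (∀ t : ℕ, t ≤ T →
          euclNorm (globalExt S e t) ≤ β (euclNorm (globalExt S e 0)) t + δ (⨆ i, Ω i)) ∧
        (∀ i, ∃ α u y, Z.Feasible (Ω i) e (T + 1) i α u y) := by
  -- Below `Ωmax` the deviations fit into the margin left by the tightened terminal regions. All
  -- constants are fixed before Ω, the execution and T.
  obtain ⟨Ωmax, hΩmax, hsmall⟩ := exists_pos_forall_classK_le hσt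
    fun i => sqrt_mul_lt_sqrt (hterm.ε_pos i) (hθ i).2.1
  choose cQ hcQ hcQ' using fun i => exists_pos_mul_le_wsq (hQ i)
  choose cR hcR hcR' using fun i => exists_pos_mul_le_wsq (hR i)
  obtain ⟨c, hc, hc'⟩ := exists_pos_le_of_forall_pos (fun i => min (cQ i) (cR i))
    fun i => lt_min (hcQ i) (hcR i)
  obtain ⟨a, ha⟩ : ∃ a : ℝ, a = M + 1 := ⟨_, rfl⟩
  obtain ⟨γ, hγ⟩ : ∃ γ : ℝ, γ = c / (n + 1) := ⟨_, rfl⟩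
  obtain ⟨μ, hμ⟩ : ∃ μ : ℝ, μ = γ / (2 * a * cub) := ⟨_, rfl⟩
  obtain ⟨b', hb'⟩ : ∃ b' : ℝ, b' = cub + γ * (n + a⁻¹) := ⟨_, rfl⟩
  obtain ⟨ρ, hρ⟩ : ∃ ρ : ℝ, ρ = γ / (2 * a * b') := ⟨_, rfl⟩
  have ha0 : 0 < a := ha ▸ by positivity
  have hγ0 : 0 < γ := hγ ▸ by positivity
  have hμ0 : 0 < μ := hμ ▸ by positivity
  have hb'0 : 0 < b' := hb' ▸ by positivity
  have hρ0 : 0 < ρ := hρ ▸ by positivity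
  -- The estimate is for ‖ξ‖², so square roots are taken: the rate ρ is halved, and √(x² + y²) ≤ x +
  -- y splits β from δ.
  refine ⟨fun r t => √(a / γ * b') * r * Real.exp (-(ρ / 2) * t),
    fun r => r + √(a / γ * ((1 + μ⁻¹) * (Z.L + 1) / ρ)) * ∑ i, (σt i r + σp i r), Ωmax,
    isClassKL_exp (Real.sqrt_pos.2 (by positivity)) (by positivity),
    isClassK_add_sum (fun i => (hσt i).add (hσp i)) (Real.sqrt_nonneg _), hΩmax,
    fun Ω hΩ hΩ' e T he hdev hV => ?_⟩
  have hle : ∀ i, Ω i ≤ ⨆ i, Ω i := le_ciSup (Set.finite_range Ω).bddAbove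
  have hsup : 0 ≤ ⨆ i, Ω i := Real.iSup_nonneg hΩ
  have hs : ∀ i, σt i (Ω i) ≤ √(Z.ε i) - √(Z.θ i * Z.ε i) := fun i =>
    hsmall i _ (hΩ i) ((hle i).trans hΩ')
  refine ⟨fun t ht => ?_, fun i => ?_⟩
  · have hgain : ∑ i, (Z.L * σp i (Ω i) ^ 2 + σt i (Ω i) ^ 2)
        ≤ (Z.L + 1) * (∑ i, (σt i (⨆ i, Ω i) + σp i (⨆ i, Ω i))) ^ 2 := by
      refine le_trans ?_ (mul_le_mul_of_nonneg_left (Finset.sum_sq_le_sq_sum_of_nonneg fun i _ =>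
        add_nonneg ((hσt i).nonneg hsup) ((hσp i).nonneg hsup)) (by positivity))
      rw [Finset.mul_sum]
      refine Finset.sum_le_sum fun i _ => ?_
      have h1 := (hσt i).mono (hΩ i) (hle i)
      have h2 := (hσp i).mono (hΩ i) (hle i)
      have h3 := (hσt i).nonneg (hΩ i)
      have h4 := (hσp i).nonneg (hΩ i)
      have h5 : σp i (Ω i) ^ 2 ≤ (σt i (⨆ i, Ω i) + σp i (⨆ i, Ω i)) ^ 2 :=
        pow_le_pow_left₀ h4 (by linarith) 2
      have h6 : σt i (Ω i) ^ 2 ≤ (σt i (⨆ i, Ω i) + σp i (⨆ i, Ω i)) ^ 2 :=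
        pow_le_pow_left₀ h3 (by linarith) 2
      have h7 := mul_le_mul_of_nonneg_left h5 (Z.L.cast_nonneg (α := ℝ))
      linarith
    have hg0 : 0 ≤ ∑ i, (σt i (⨆ i, Ω i) + σp i (⨆ i, Ω i)) :=
      Finset.sum_nonneg fun i _ => add_nonneg ((hσt i).nonneg hsup) ((hσp i).nonneg hsup)
    obtain ⟨g, hg⟩ : ∃ g, g = ∑ i, (σt i (⨆ i, Ω i) + σp i (⨆ i, Ω i)) := ⟨_, rfl⟩
    simp only [← hg] at hgain hg0 ⊢
    have key := sq_le_of_cost_decrease (X := fun t => euclNorm (globalExt S e t))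
      (V := Z.optCost e) (f := e.stageSq) (d := (1 + μ⁻¹) * ((Z.L + 1) * g ^ 2)) ha0 hcub hc
      (by positivity) e.stageSq_nonneg (Scheme.optCost_nonneg hQ hR hterm.posDef e)
      (sum_stageSq_le S e) (fun t => ha ▸ euclNorm_globalExt_sq_le S e t) hV hγ hμ hb' hρ
      (fun s hs' => (he.optCost_succ_le hdata hCt hL hQ hR hterm hθ hΩ hdev hs hμ0
        (fun i x => le_trans (mul_le_mul_of_nonneg_right ((hc' i).trans (min_le_left _ _))
          (sq_nonneg _)) (hcQ' i x))
        (fun i x => le_trans (mul_le_mul_of_nonneg_right ((hc' i).trans (min_le_right _ _))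
          (sq_nonneg _)) (hcR' i x)) hs').trans
          (add_le_add_right (mul_le_mul_of_nonneg_left hgain (by positivity)) _)) t ht
    have hr : 0 ≤ euclNorm (globalExt S e 0) := euclNorm_nonneg _
    have hβ0 : 0 ≤ √(a / γ * b') * euclNorm (globalExt S e 0) * Real.exp (-(ρ / 2) * t) := by
      positivity
    have hδ0 : 0 ≤ √(a / γ * ((1 + μ⁻¹) * (Z.L + 1) / ρ)) * g := by positivity
    refine (pow_le_pow_iff_left₀ (euclNorm_nonneg _) (by positivity) two_ne_zero).1
      (le_trans (b := (√(a / γ * b') * euclNorm (globalExt S e 0) * Real.exp (-(ρ / 2) * t)) ^ 2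
        + (√(a / γ * ((1 + μ⁻¹) * (Z.L + 1) / ρ)) * g) ^ 2) (key.trans_eq ?_) ?_)
    · rw [mul_pow, mul_pow, mul_pow, Real.sq_sqrt (by positivity), Real.sq_sqrt (by positivity),
        ← Real.exp_nat_mul, show ((2 : ℕ) : ℝ) * (-(ρ / 2) * t) = -ρ * t by push_cast; ring]
      ring
    · have h1 := mul_nonneg hβ0 hδ0
      refine le_trans ?_ (pow_le_pow_left₀ (add_nonneg hβ0 hδ0) (by linarith) 2)
      rw [add_sq]
      linarith
  -- The candidate formed at time T witnesses feasibility at T + 1, without a step at T + 1.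
  · have hst := he.step T (by omega) le_rfl
    obtain ⟨α, hf⟩ := hst.cand_feasible hdata hCt hL hQ hR hterm hθ (hΩ i)
      (hst.candState_mem hterm (hdev.state i T (by omega) le_rfl) (hs i))
    exact ⟨α, _, _, hf⟩
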